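/- **Theorem 2.** Let $\nu>-1/2$ and $\rho_\nu(x)=2x^{\nu/2}K_\nu(2\sqrt x)$ for $x>0$, where $K_\nu$ is the Macdonald function. Let $(a)_k$ be the Pochhammer symbol, $L_r^\nu$ the Laguerre polynomials, $\Gamma(a,z)=\int_z^\infty e^{-u}u^{a-1}\,du$, and let $\theta=tDt$ act by $(\theta g)(t)=t\,(t\,g(t))'$. For $n,m,k,r\in\mathbb N_0$ put $$c_{n,r}=\frac{r!}{\Gamma(1+\nu+r)}\int_0^\infty t^\nu e^{-t}L_r^\nu(t)\,\theta^n\{t^\nu e^t\Gamma(-\nu,t)\}\,dt,\qquad d_{m,r}=\int_0^\infty t^{\nu+m}e^{-t}L_m^\nu(t)L_r^\nu(t)\,dt,$$ $$f_{k,m}=\sum_{r=0}^{2m}c_{k,r}\,d_{m,r}.$$ Let $D_n=\det\big(f_{j,m}\big)$ with rows $m=0,\dots,n-1$ and columns $j=1,\dots,n$ (so $D_0=1$). For $1\le k\le n$ let $D_{n,k}$ be $D_n$ with column $k$ replaced by $(f_{0,m})_{0\le m\le n-1}$, and let $D_{n,0}=-D_n$. Put $$S_n=\sqrt\pi\,\frac{\Gamma(1+2\nu)\Gamma(1+\nu)}{2^{1+2\nu}\Gamma(\nu+3/2)}\sum_{k=0}^nD_{n,k}\,(n+k)!\,\frac{(1+2\nu)_{n+k}(1+\nu)_{n+k}}{4^{n+k}(\nu+3/2)_{n+k}}.$$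 All moments of $\rho_\nu^2$ on $(0,\infty)$ are finite, and there is a unique sequence of real polynomials $P_n(x)=\sum_{k=0}^na_{n,k}x^k$ with $a_{n,n}>0$ and $\int_0^\infty P_nP_m\,\rho_\nu^2\,dx=\delta_{n,m}$. Moreover: 1. The integrals defining $c_{n,r}$ and $d_{m,r}$ converge absolutely, and $$c_{n,r}=n!\,(1+\nu)_n^2\,\frac{\Gamma(2\nu+n+1)}{\Gamma(2\nu+2n+2)}\;{}_3F_2(-r,\ \nu+n+1,\ 2\nu+n+1;\ 1+\nu,\ 2\nu+2n+2;\ 1),$$ $$d_{m,r}=\frac{(-1)^m}{r!}(1+\nu)_r\,\Gamma(1+\nu+m)\;{}_3F_2(-r,\ \nu+m+1,\ m+1;\ 1+\nu,\ 1;\ 1).$$ 2. For every $n$, $D_n\ne0$ and $D_{n,n}S_n>0$. 3. Let $P_n(x)=\sum_{k=0}^na_{n,k}x^k$ with $a_{n,n}\neq0$ be any orthonormal sequence for $\rho_\nu^2$. Then $$a_{n,k}=-a_{n,0}\frac{D_{n,k}}{D_n}\quad(1\le k\le n),\qquad a_{n,0}=\pm\frac{D_n}{|D_{n,n}|^{1/2}}\,|S_n|^{-1/2}.$$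 If $a_{n,n}>0$, the sign in the last formula is $-\operatorname{sgn}D_{n,n}$, and $a_{n,n}=|D_{n,n}|^{1/2}|S_n|^{-1/2}$. 4. With $P_{-1}=0$, every such sequence satisfies, for all $n\ge0$, $$xP_n(x)=A_{n+1}P_{n+1}(x)+B_nP_n(x)+A_nP_{n-1}(x),$$ $$A_{n+1}=\frac{a_{n,n}}{a_{n+1,n+1}}=\frac{a_{n,0}\,D_{n+1}\,D_{n,n}}{a_{n+1,0}\,D_n\,D_{n+1,n+1}},\qquad B_n=\frac{a_{n,n-1}}{a_{n,n}}-\frac{a_{n+1,n}}{a_{n+1,n+1}}=\frac{D_{n,n-1}}{D_{n,n}}-\frac{D_{n+1,n}}{D_{n+1,n+1}},$$ where for $n=0$ the first term of each expression for $B_n$ is $0$. -/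

import Mathlib

open MeasureTheory Set Polynomial

noncomputable section

/-- The Macdonald function (modified Bessel function of the second kind)
`K_ν(z) = ∫₀^∞ e^{-z cosh u} cosh(νu) du`, for `z > 0`. -/
def macdonaldK (ν z : ℝ) : ℝ :=
  ∫ u in Ioi (0 : ℝ), Real.exp (-z * Real.cosh u) * Real.cosh (ν * u)

/-- `ρ_ν(x) = 2 x^{ν/2} K_ν(2√x)`, for `x > 0`. -/
def rhoWeight (ν x : ℝ) : ℝ :=
  2 * x ^ (ν / 2) * macdonaldK ν (2 * Real.sqrt x)

/-- `P 0, P 1, …` are real polynomials, `P n` of exact degree `n`, orthonormal on `(0, ∞)` for the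
weight `ρ_ν²`. -/
def IsOrthonormalSeq (ν : ℝ) (P : ℕ → ℝ[X]) : Prop :=
  (∀ n, (P n).degree = n) ∧
    ∀ n m, ∫ x in Ioi (0 : ℝ), (P m).eval x * (P n).eval x * rhoWeight ν x ^ 2 =
      if n = m then 1 else 0

/-- The Pochhammer symbol `(a)_k = a (a+1) ⋯ (a+k-1)`. -/
def poch (a : ℝ) (k : ℕ) : ℝ := (ascPochhammer ℝ k).eval a

/-- The generalized hypergeometric series `₃F₂(a₁, a₂, a₃; b₁, b₂; z)`. -/
def hyp3F2 (a₁ a₂ a₃ b₁ b₂ z : ℝ) : ℝ :=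
  ∑' j : ℕ, poch a₁ j * poch a₂ j * poch a₃ j / (poch b₁ j * poch b₂ j * (j.factorial : ℝ)) * z ^ j

/-- The Laguerre polynomial
`L_n^ν(t) = ∑_{j ≤ n} (ν+j+1)_{n-j} / ((n-j)! j!) (-t)^j`; the quotient `(ν+j+1)_{n-j} / (n-j)!` is
the binomial coefficient of `n + ν` over `n - j`. -/
def laguerreL (ν : ℝ) (n : ℕ) (t : ℝ) : ℝ :=
  ∑ j ∈ Finset.range (n + 1),
    poch (ν + j + 1) (n - j) / (((n - j).factorial : ℝ) * (j.factorial : ℝ)) * (-t) ^ j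

/-- The upper incomplete gamma function `Γ(a, z) = ∫_z^∞ e^{-u} u^{a-1} du`. -/
def upperGamma (a z : ℝ) : ℝ := ∫ u in Ioi z, Real.exp (-u) * u ^ (a - 1)

/-- The operator `θ = t D t`, that is `(θ g)(t) = t (t g(t))'`. -/
def thetaOp (g : ℝ → ℝ) : ℝ → ℝ := fun t => t * deriv (fun s => s * g s) t

/-- `F_n = θ^n { t^ν e^t Γ(-ν, t) }`. -/
def thetaGamma (ν : ℝ) (n : ℕ) : ℝ → ℝ :=
  thetaOp^[n] (fun t => t ^ ν * Real.exp t * upperGamma (-ν) t)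

/-- The Laguerre coefficients
`c_{n,r} = r! / Γ(1+ν+r) ∫₀^∞ t^ν e^{-t} L_r^ν(t) F_n(t) dt` of `F_n`. -/
def coeffC (ν : ℝ) (n r : ℕ) : ℝ :=
  (r.factorial : ℝ) / Real.Gamma (1 + ν + r) *
    ∫ t in Ioi (0 : ℝ), t ^ ν * Real.exp (-t) * laguerreL ν r t * thetaGamma ν n t

/-- `d_{m,r} = ∫₀^∞ t^{ν+m} e^{-t} L_m^ν(t) L_r^ν(t) dt`. -/
def coeffD (ν : ℝ) (m r : ℕ) : ℝ :=
  ∫ t in Ioi (0 : ℝ), t ^ (ν + m) * Real.exp (-t) * laguerreL ν m t * laguerreL ν r t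

/-- `f_{k,m} = ∑_{r=0}^{2m} c_{k,r} d_{m,r}`. -/
def coeffF (ν : ℝ) (k m : ℕ) : ℝ :=
  ∑ r ∈ Finset.range (2 * m + 1), coeffC ν k r * coeffD ν m r

/-- `D_n`, the determinant with the entry `f_{j,m}` in row `m = 0, …, n-1` and column
`j = 1, …, n` (the empty determinant is `1`). -/
def detD (ν : ℝ) (n : ℕ) : ℝ :=
  (Matrix.of fun m j : Fin n => coeffF ν (j + 1) m).det

/-- `D_{n,k}`: for `1 ≤ k ≤ n` it is `D_n` with column `k` replaced by `f_{0,0}, …, f_{0,n-1}`;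
`D_{n,0} = -D_n`. -/
def detDk (ν : ℝ) (n k : ℕ) : ℝ :=
  if k = 0 then -detD ν n
  else (Matrix.of fun m j : Fin n =>
    coeffF ν (if (j : ℕ) + 1 = k then 0 else j + 1) m).det

/-- The bracket `S_n` in the formula for the free term. -/
def sumS (ν : ℝ) (n : ℕ) : ℝ :=
  Real.sqrt Real.pi *
    (Real.Gamma (1 + 2 * ν) * Real.Gamma (1 + ν) /
      ((2 : ℝ) ^ (1 + 2 * ν) * Real.Gamma (ν + 3 / 2))) *
    ∑ k ∈ Finset.range (n + 1),
      detDk ν n k * ((n + k).factorial : ℝ) *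
        (poch (1 + 2 * ν) (n + k) * poch (1 + ν) (n + k) /
          ((4 : ℝ) ^ (n + k) * poch (ν + 3 / 2) (n + k)))

end

/-!
The point is that the numbers `f_{k,m}` are moments of the weight in disguise,
`f_{k,m} = (-1)^m / (m! Γ(1+ν)) ∫₀^∞ x^{k+m} ρ_ν(x)² dx` (`coeffF_eq`), with a factor depending only
on the row `m`. The determinants are therefore Hankel determinants up to nonzero row factors, and
Cramer's rule says that `∑ₖ D_{n,k} x^k` (`detPoly`) is orthogonal to all lower degrees.

The moment formula has an analytic and an algebraic half. On the analytic side,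
`t^ν e^t Γ(-ν, t)` is the Stieltjes transform of a gamma density (`rpow_mul_exp_mul_upperGamma`),
and `θ` acts on the kernel `t^n / (t+u)^{n+1}` by raising `n` (`thetaGamma_eq`). So the moments of
`θⁿ {t^ν e^t Γ(-ν, t)}` against `t^{ν+j} e^{-t}`, and, after the substitution
`ρ_ν(x) = ∫₀^∞ t^{ν-1} e^{-t-x/t} dt`, the moments of `ρ_ν²`, are all cases of one double gamma
integral (`lintegral_lintegral_gamma_kernel`), whose values are the gamma quotients `mixedMoment`.
On the algebraic side, the sum over `r` in `f_{k,m}` is Parseval's identity for the Laguerre system,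
which is binomial inversion here (`sum_choose_mul_laguerreCoeff`), and the remaining sum over the
coefficients of `L_m^ν` collapses by induction on `m` from the recurrence
`x ρ_b = ρ_{b+2} - (b+1) ρ_{b+1}` (`sum_laguerreCoeff_mul_mixedMoment`).

The rest is the theory of orthogonal polynomials for the positive functional
`p ↦ ∫₀^∞ p ρ_ν² dx` (`momentFunctional`). Positivity on `X p²` gives `D_n ≠ 0` and shows that an
orthonormal polynomial is determined by its constant term, hence is a multiple of `detPoly`;
the square of `detPoly` integrates to `D_{n,n} S_n` (`momentFunctional_detPoly_mul_self`), which
fixes the normalisation.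
-/

/-! ### Gamma and beta integrals -/

lemma integrableOn_rpow_mul_exp_neg_mul {a r : ℝ} (ha : 0 < a) (hr : 0 < r) :
    IntegrableOn (fun t : ℝ => t ^ (a - 1) * Real.exp (-(r * t))) (Ioi 0) := by
  by_contra h
  have h1 := Real.integral_rpow_mul_exp_neg_mul_Ioi ha hr
  rw [integral_undef h] at h1
  have : 0 < (1 / r) ^ a * Real.Gamma a :=
    mul_pos (Real.rpow_pos_of_pos (by positivity) _) (Real.Gamma_pos_of_pos ha)
  exact this.ne h1

lemma lintegral_rpow_mul_exp_neg_mul {a r : ℝ} (ha : 0 < a) (hr : 0 < r) :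
    ∫⁻ t in Ioi (0 : ℝ), ENNReal.ofReal (t ^ (a - 1) * Real.exp (-(r * t))) =
      ENNReal.ofReal ((1 / r) ^ a * Real.Gamma a) := by
  rw [← Real.integral_rpow_mul_exp_neg_mul_Ioi ha hr, ofReal_integral_eq_lintegral_ofReal
    (integrableOn_rpow_mul_exp_neg_mul ha hr)]
  refine (ae_restrict_mem measurableSet_Ioi).mono fun t (ht : 0 < t) => ?_
  have := Real.rpow_pos_of_pos ht (a - 1)
  positivity

lemma lintegral_Ioi_comp_mul_left (g : ℝ → ENNReal) {t : ℝ} (ht : 0 < t) :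
    ∫⁻ u in Ioi (0 : ℝ), g u = ∫⁻ v in Ioi (0 : ℝ), ENNReal.ofReal t * g (t * v) := by
  have himg : (fun v => t * v) '' Ioi (0 : ℝ) = Ioi 0 := by
    rw [image_mul_left_Ioi ht, mul_zero]
  have := lintegral_image_eq_lintegral_abs_deriv_mul (f := fun v => t * v) (f' := fun _ => t)
    (measurableSet_Ioi (a := (0 : ℝ)))
    (fun x _ => by simpa using ((hasDerivAt_id x).const_mul t).hasDerivWithinAt)
    (fun x _ y _ h => mul_left_cancel₀ ht.ne' h) g
  rw [himg] at this
  simpa [abs_of_pos ht] using this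

/-- The substitution `u = t v` separates the variables, up to a beta integral which does not depend
on `N`. -/
lemma lintegral_lintegral_gamma_kernel_eq_mul {p q : ℝ} (N : ℕ)
    (hN : N < p + q) :
    ∫⁻ t in Ioi (0 : ℝ), ∫⁻ u in Ioi (0 : ℝ), ENNReal.ofReal
        (t ^ (q - 1) * Real.exp (-t) * (Real.exp (-u) * u ^ (p - 1) / (t + u) ^ N)) =
      (∫⁻ v in Ioi (0 : ℝ), ENNReal.ofReal (v ^ (p - 1) * (1 / (1 + v)) ^ (p + q))) *
        ENNReal.ofReal (Real.Gamma (p + q - N)) := by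
  have hs : 0 < p + q - N := by linarith
  have h1 : ∀ t ∈ Ioi (0 : ℝ), ∫⁻ u in Ioi (0 : ℝ), ENNReal.ofReal
        (t ^ (q - 1) * Real.exp (-t) * (Real.exp (-u) * u ^ (p - 1) / (t + u) ^ N)) =
      ∫⁻ v in Ioi (0 : ℝ), ENNReal.ofReal (v ^ (p - 1) / (1 + v) ^ N) *
        ENNReal.ofReal (t ^ (p + q - N - 1) * Real.exp (-((1 + v) * t))) := by
    intro t (ht : 0 < t)
    rw [lintegral_Ioi_comp_mul_left _ ht]
    refine setLIntegral_congr_fun measurableSet_Ioi fun v (hv : 0 < v) => ?_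
    have hv' := Real.rpow_pos_of_pos hv (p - 1)
    rw [← ENNReal.ofReal_mul ht.le, ← ENNReal.ofReal_mul (by positivity)]
    congr 1
    have e1 : t ^ (p + q - N - 1) = t * t ^ (q - 1) * t ^ (p - 1) / t ^ N := by
      rw [show p + q - N - 1 = 1 + (q - 1) + (p - 1) - N by ring, Real.rpow_sub ht,
        Real.rpow_add ht, Real.rpow_add ht, Real.rpow_one, Real.rpow_natCast]
    have e2 : Real.exp (-((1 + v) * t)) = Real.exp (-t) * Real.exp (-(t * v)) := by
      rw [← Real.exp_add]; ring_nf
    have e3 : (t + t * v) ^ N = t ^ N * (1 + v) ^ N := by rw [← mul_pow]; ring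
    rw [e1, e2, e3, Real.mul_rpow ht.le hv.le]
    field_simp
  rw [setLIntegral_congr_fun measurableSet_Ioi h1, lintegral_lintegral_swap
    (by exact Measurable.aemeasurable (by fun_prop)), ← lintegral_mul_const _ (by fun_prop)]
  refine setLIntegral_congr_fun measurableSet_Ioi fun v (hv : 0 < v) => ?_
  have hv' := Real.rpow_pos_of_pos hv (p - 1)
  have hv2 : 0 < 1 + v := by positivity
  rw [lintegral_const_mul _ (by fun_prop), lintegral_rpow_mul_exp_neg_mul hs hv2,
    ← ENNReal.ofReal_mul (by positivity),
    ← ENNReal.ofReal_mul (mul_nonneg hv'.le (Real.rpow_nonneg (by positivity) _))]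
  congr 1
  have e1 : (1 / (1 + v)) ^ (p + q) = (1 / (1 + v)) ^ (p + q - N) * (1 / (1 + v)) ^ N := by
    rw [← Real.rpow_natCast, ← Real.rpow_add (by positivity)]
    ring_nf
  rw [e1, div_pow, one_pow]
  field_simp

/-- The double integral behind all moments below: the Mellin convolution of the kernel
`(t + u)^(-N)` with two gamma densities. The beta integral is found from the case `N = 0`, where
the variables separate. -/
lemma lintegral_lintegral_gamma_kernel {p q : ℝ} (hp : 0 < p) (hq : 0 < q) (N : ℕ)
    (hN : N < p + q) :
    ∫⁻ t in Ioi (0 : ℝ), ∫⁻ u in Ioi (0 : ℝ), ENNReal.ofReal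
        (t ^ (q - 1) * Real.exp (-t) * (Real.exp (-u) * u ^ (p - 1) / (t + u) ^ N)) =
      ENNReal.ofReal (Real.Gamma p * Real.Gamma q * Real.Gamma (p + q - N) /
        Real.Gamma (p + q)) := by
  have gp := Real.Gamma_pos_of_pos hp
  have gq := Real.Gamma_pos_of_pos hq
  have gpq := Real.Gamma_pos_of_pos (add_pos hp hq)
  have gs := Real.Gamma_pos_of_pos (show 0 < p + q - N by linarith)
  have h0 := lintegral_lintegral_gamma_kernel_eq_mul (p := p) (q := q) 0 (by simp; linarith)
  rw [lintegral_lintegral_gamma_kernel_eq_mul N hN]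
  have h1 : ∫⁻ t in Ioi (0 : ℝ), ∫⁻ u in Ioi (0 : ℝ), ENNReal.ofReal
        (t ^ (q - 1) * Real.exp (-t) * (Real.exp (-u) * u ^ (p - 1) / (t + u) ^ 0)) =
      ENNReal.ofReal (Real.Gamma q) * ENNReal.ofReal (Real.Gamma p) := by
    have hg : ∀ a : ℝ, 0 < a → ∫⁻ t in Ioi (0 : ℝ), ENNReal.ofReal
        (t ^ (a - 1) * Real.exp (-t)) = ENNReal.ofReal (Real.Gamma a) := by
      intro a ha
      simpa using lintegral_rpow_mul_exp_neg_mul ha one_pos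
    rw [← hg q hq, ← hg p hp, ← lintegral_mul_const _ (by fun_prop)]
    refine setLIntegral_congr_fun measurableSet_Ioi fun t (ht : 0 < t) => ?_
    have ht' := Real.rpow_pos_of_pos ht (q - 1)
    rw [← lintegral_const_mul _ (by fun_prop)]
    refine lintegral_congr fun u => ?_
    rw [← ENNReal.ofReal_mul (by positivity), pow_zero, div_one, mul_comm (Real.exp (-u))]
  rw [h1, Nat.cast_zero, sub_zero] at h0
  set B := ∫⁻ v in Ioi (0 : ℝ), ENNReal.ofReal (v ^ (p - 1) * (1 / (1 + v)) ^ (p + q))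
  have hne : ENNReal.ofReal (Real.Gamma (p + q)) ≠ 0 := by simpa using gpq
  have hB : B = ENNReal.ofReal (Real.Gamma p * Real.Gamma q / Real.Gamma (p + q)) := by
    rw [ENNReal.ofReal_div_of_pos gpq, mul_comm (Real.Gamma p), ENNReal.ofReal_mul gq.le, h0,
      ENNReal.mul_div_cancel_right hne ENNReal.ofReal_ne_top]
  rw [hB, ← ENNReal.ofReal_mul (by positivity)]
  congr 1
  ring

/-- Tonelli's theorem for a nonnegative kernel, in the form of an evaluation of the Bochner integral
of the inner integral. -/
lemma integrableOn_and_integral_eq_of_lintegral {g : ℝ → ℝ} {h : ℝ → ℝ → ℝ} {V : ℝ} (hV : 0 ≤ V)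
    (hm : Measurable (Function.uncurry h))
    (hint : ∀ t, 0 < t → IntegrableOn (h t) (Ioi 0))
    (hnn : ∀ t, 0 < t → ∀ u, 0 < u → 0 ≤ h t u)
    (hg : ∀ t, 0 < t → g t = ∫ u in Ioi (0 : ℝ), h t u)
    (hI : ∫⁻ t in Ioi (0 : ℝ), ∫⁻ u in Ioi (0 : ℝ), ENNReal.ofReal (h t u) = ENNReal.ofReal V) :
    IntegrableOn g (Ioi 0) ∧ ∫ t in Ioi (0 : ℝ), g t = V := by
  have hae : ∀ t, 0 < t → 0 ≤ᵐ[volume.restrict (Ioi 0)] h t := fun t ht =>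
    (ae_restrict_mem measurableSet_Ioi).mono fun u hu => hnn t ht u hu
  have hl : ∀ t, 0 < t → ENNReal.ofReal (g t) = ∫⁻ u in Ioi (0 : ℝ), ENNReal.ofReal (h t u) :=
    fun t ht => by rw [hg t ht, ofReal_integral_eq_lintegral_ofReal (hint t ht) (hae t ht)]
  have hg0 : 0 ≤ᵐ[volume.restrict (Ioi 0)] g :=
    (ae_restrict_mem measurableSet_Ioi).mono fun t ht => by
      rw [hg t ht]; exact integral_nonneg_of_ae (hae t ht)
  have hL : ∫⁻ t in Ioi (0 : ℝ), ENNReal.ofReal (g t) = ENNReal.ofReal V := by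
    rw [← hI]; exact setLIntegral_congr_fun measurableSet_Ioi fun t ht => hl t ht
  have hmeas : AEStronglyMeasurable g (volume.restrict (Ioi 0)) := by
    refine AEStronglyMeasurable.congr (f := fun t => ∫ u in Ioi (0 : ℝ), h t u) ?_
      ((ae_restrict_mem measurableSet_Ioi).mono fun t ht => (hg t ht).symm)
    exact (hm.stronglyMeasurable.integral_prod_right).aestronglyMeasurable
  have hi : IntegrableOn g (Ioi 0) :=
    ⟨hmeas, by rw [hasFiniteIntegral_iff_ofReal hg0, hL]; exact ENNReal.ofReal_lt_top⟩
  refine ⟨hi, ?_⟩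
  rw [integral_eq_lintegral_of_nonneg_ae hg0 hmeas, hL, ENNReal.toReal_ofReal hV]

/-! ### The functions `θⁿ {t^ν e^t Γ(-ν, t)}` as Stieltjes transforms -/

lemma integrableOn_exp_mul_rpow_div {t s : ℝ} (ht : 0 < t) (hs : 0 < s) (N : ℕ) :
    IntegrableOn (fun u : ℝ => Real.exp (-u) * u ^ (s - 1) / (t + u) ^ N) (Ioi 0) := by
  have h := (integrableOn_rpow_mul_exp_neg_mul hs one_pos).const_mul (1 / t ^ N)
  refine Integrable.mono' h (Measurable.aestronglyMeasurable (by fun_prop))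
    ((ae_restrict_mem measurableSet_Ioi).mono fun u (hu : 0 < u) => ?_)
  have hu' := Real.rpow_pos_of_pos hu (s - 1)
  rw [Real.norm_of_nonneg (by positivity), one_mul, mul_comm (Real.exp (-u)), one_div_mul_eq_div]
  gcongr
  linarith

/-- `t^ν e^t Γ(-ν, t)` is the Stieltjes transform of a gamma density. -/
lemma rpow_mul_exp_mul_upperGamma {ν t : ℝ} (hν : 0 < ν + 1) (ht : 0 < t) :
    t ^ ν * Real.exp t * upperGamma (-ν) t =
      1 / Real.Gamma (1 + ν) *
        ∫ u in Ioi (0 : ℝ), Real.exp (-u) * u ^ (ν + 1 - 1) / (t + u) ^ 1 := by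
  have hΓ := Real.Gamma_pos_of_pos (show 0 < 1 + ν by linarith)
  have himg : (fun w => t * (1 + w)) '' Ioi (0 : ℝ) = Ioi t := by
    have : (fun w => t * (1 + w)) '' Ioi (0 : ℝ) =
        (fun w => t * w) '' ((fun w => 1 + w) '' Ioi (0 : ℝ)) := by rw [image_image]
    rw [this, image_const_add_Ioi, image_mul_left_Ioi ht, add_zero, mul_one]
  have hsub := integral_image_eq_integral_abs_deriv_smul (f := fun w => t * (1 + w))
    (f' := fun _ => t) (measurableSet_Ioi (a := (0 : ℝ)))
    (fun x _ => by
      simpa using (((hasDerivAt_id x).const_add 1).const_mul t).hasDerivWithinAt)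
    (fun x _ y _ h => add_left_cancel (mul_left_cancel₀ ht.ne' h))
    (fun v => Real.exp (-v) * v ^ (-ν - 1))
  rw [himg] at hsub
  have hV : 0 ≤ ∫ u in Ioi (0 : ℝ), Real.exp (-u) * u ^ (ν + 1 - 1) / (t + u) ^ 1 :=
    setIntegral_nonneg measurableSet_Ioi fun u (hu : 0 < u) => by
      have := Real.rpow_pos_of_pos hu (ν + 1 - 1)
      positivity
  -- `1 / (t + u)` is the Laplace transform of `1`; Tonelli exchanges it with the `u`-integral.
  have key := integrableOn_and_integral_eq_of_lintegral
    (g := fun w => Real.exp (-(t * w)) * ((1 / (1 + w)) ^ (ν + 1) * Real.Gamma (ν + 1)))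
    (h := fun w u => Real.exp (-(t * w)) * (u ^ (ν + 1 - 1) * Real.exp (-((1 + w) * u))))
    hV (by unfold Function.uncurry; fun_prop)
    (fun w (hw : 0 < w) => (integrableOn_rpow_mul_exp_neg_mul hν (by positivity)).const_mul _)
    (fun w hw u hu => by have := Real.rpow_pos_of_pos hu (ν + 1 - 1); positivity)
    (fun w hw => by
      rw [integral_const_mul, Real.integral_rpow_mul_exp_neg_mul_Ioi hν (by positivity)])
    (by
      rw [lintegral_lintegral_swap (by exact Measurable.aemeasurable (by fun_prop)),
        ofReal_integral_eq_lintegral_ofReal (integrableOn_exp_mul_rpow_div ht hν 1)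
          ((ae_restrict_mem measurableSet_Ioi).mono fun u (hu : 0 < u) => by
            have := Real.rpow_pos_of_pos hu (ν + 1 - 1)
            simp only [Pi.zero_apply]
            positivity)]
      refine setLIntegral_congr_fun measurableSet_Ioi fun u (hu : 0 < u) => ?_
      have hu' := Real.rpow_pos_of_pos hu (ν + 1 - 1)
      have hL := lintegral_rpow_mul_exp_neg_mul one_pos (show 0 < t + u by positivity)
      simp only [sub_self, Real.rpow_zero, one_mul, Real.Gamma_one, mul_one, Real.rpow_one] at hL
      have : ∀ w : ℝ, ENNReal.ofReal (Real.exp (-(t * w)) *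
          (u ^ (ν + 1 - 1) * Real.exp (-((1 + w) * u)))) =
          ENNReal.ofReal (Real.exp (-u) * u ^ (ν + 1 - 1)) *
            ENNReal.ofReal (Real.exp (-((t + u) * w))) := by
        intro w
        rw [← ENNReal.ofReal_mul (by positivity)]
        congr 1
        have : Real.exp (-(t * w)) * Real.exp (-((1 + w) * u)) =
            Real.exp (-u) * Real.exp (-((t + u) * w)) := by
          rw [← Real.exp_add, ← Real.exp_add]; ring_nf
        linear_combination u ^ (ν + 1 - 1) * this
      simp only [this]
      rw [lintegral_const_mul _ (by fun_prop), hL, ← ENNReal.ofReal_mul (by positivity)]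
      congr 1
      ring)
  rw [← key.2, upperGamma, hsub, ← integral_const_mul, ← integral_const_mul]
  refine setIntegral_congr_fun measurableSet_Ioi fun w (hw : 0 < w) => ?_
  have hw1 : 0 < 1 + w := by positivity
  have e1 : Real.exp (-(t * (1 + w))) = (Real.exp t)⁻¹ * Real.exp (-(t * w)) := by
    rw [← Real.exp_neg, ← Real.exp_add]; ring_nf
  have e2 : (t * (1 + w)) ^ (-ν - 1) = (t ^ ν)⁻¹ * t⁻¹ * (1 / (1 + w)) ^ (ν + 1) := by
    rw [Real.mul_rpow ht.le hw1.le, show -ν - 1 = -ν + -1 by ring, Real.rpow_add ht,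
      Real.rpow_neg ht.le, Real.rpow_neg_one, ← neg_add, Real.rpow_neg hw1.le, one_div,
      Real.inv_rpow hw1.le]
  have ht' := Real.rpow_pos_of_pos ht ν
  simp only [abs_of_pos ht, smul_eq_mul]
  rw [e1, e2, add_comm 1 ν] at *
  field_simp

/-- Differentiation under the integral sign: the action of `θ` on the kernels. -/
lemma hasDerivAt_stieltjes {s t : ℝ} (hs : 0 < s) (ht : 0 < t) (n : ℕ) :
    HasDerivAt (fun t => ∫ u in Ioi (0 : ℝ), Real.exp (-u) * u ^ (s - 1) * (t / (t + u)) ^ (n + 1))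
      (∫ u in Ioi (0 : ℝ), (n + 1) *
        (Real.exp (-u) * u ^ (s - 1) * ((t / (t + u)) ^ n * (u / (t + u) ^ 2)))) t := by
  have hbase : IntegrableOn (fun u : ℝ => Real.exp (-u) * u ^ (s - 1)) (Ioi 0) := by
    simpa [mul_comm] using integrableOn_rpow_mul_exp_neg_mul hs one_pos
  have hle : ∀ x u : ℝ, 0 < x → 0 < u → x / (x + u) ≤ 1 := fun x u hx hu => by
    rw [div_le_one (by positivity)]; linarith
  refine (hasDerivAt_integral_of_dominated_loc_of_deriv_le
    (μ := volume.restrict (Ioi (0 : ℝ))) (s := Ioi (t / 2))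
    (F := fun t u => Real.exp (-u) * u ^ (s - 1) * (t / (t + u)) ^ (n + 1))
    (F' := fun t u => (n + 1) *
        (Real.exp (-u) * u ^ (s - 1) * ((t / (t + u)) ^ n * (u / (t + u) ^ 2))))
    (bound := fun u => (n + 1) * (2 / t) * (Real.exp (-u) * u ^ (s - 1)))
    (Ioi_mem_nhds (by linarith)) ?_ ?_ ?_ ?_ (hbase.const_mul _) ?_).2
  · exact Filter.Eventually.of_forall fun x =>
      Measurable.aestronglyMeasurable (by fun_prop)
  · refine Integrable.mono' hbase (Measurable.aestronglyMeasurable (by fun_prop))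
      ((ae_restrict_mem measurableSet_Ioi).mono fun u (hu : 0 < u) => ?_)
    have hu' := Real.rpow_pos_of_pos hu (s - 1)
    rw [Real.norm_of_nonneg (by positivity)]
    exact mul_le_of_le_one_right (by positivity) (pow_le_one₀ (by positivity) (hle t u ht hu))
  · exact Measurable.aestronglyMeasurable (by fun_prop)
  · refine (ae_restrict_mem measurableSet_Ioi).mono fun u (hu : 0 < u) x (hx : t / 2 < x) => ?_
    have hu' := Real.rpow_pos_of_pos hu (s - 1)
    have hx0 : 0 < x := by linarith
    rw [Real.norm_of_nonneg (by positivity)]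
    have h1 : (x / (x + u)) ^ n ≤ 1 := pow_le_one₀ (by positivity) (hle x u hx0 hu)
    have h2 : u / (x + u) ^ 2 ≤ 2 / t := by
      rw [div_le_div_iff₀ (by positivity) ht]
      nlinarith
    have h3 : (x / (x + u)) ^ n * (u / (x + u) ^ 2) ≤ 1 * (2 / t) :=
      mul_le_mul h1 h2 (by positivity) zero_le_one
    calc (n + 1 : ℝ) * (Real.exp (-u) * u ^ (s - 1) * ((x / (x + u)) ^ n * (u / (x + u) ^ 2)))
        ≤ (n + 1 : ℝ) * (Real.exp (-u) * u ^ (s - 1) * (1 * (2 / t))) := by gcongr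
      _ = _ := by ring
  · refine (ae_restrict_mem measurableSet_Ioi).mono fun u (hu : 0 < u) x (hx : t / 2 < x) => ?_
    have hx0 : 0 < x := by linarith
    have hxu : x + u ≠ 0 := by positivity
    have h : HasDerivAt (fun x => x / (x + u)) (u / (x + u) ^ 2) x := by
      have h := (hasDerivAt_id' x).fun_div ((hasDerivAt_id' x).add_const u) hxu
      exact h.congr_deriv (by ring)
    refine ((h.fun_pow (n + 1)).const_mul (Real.exp (-u) * u ^ (s - 1))).congr_deriv ?_
    push_cast
    ring

/-- The Stieltjes transform formula for `θⁿ {t^ν e^t Γ(-ν, t)}`. -/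
lemma thetaGamma_eq {ν : ℝ} (hν : 0 < ν + 1) (n : ℕ) {t : ℝ} (ht : 0 < t) :
    thetaGamma ν n t = (n.factorial : ℝ) / Real.Gamma (1 + ν) * (t ^ n *
      ∫ u in Ioi (0 : ℝ), Real.exp (-u) * u ^ (ν + n + 1 - 1) / (t + u) ^ (n + 1)) := by
  induction n generalizing t with
  | zero =>
    simpa [thetaGamma] using rpow_mul_exp_mul_upperGamma hν ht
  | succ n ih =>
    have hstep : thetaGamma ν (n + 1) = thetaOp (thetaGamma ν n) := by
      unfold thetaGamma
      rw [Function.iterate_succ_apply']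
    have hs : 0 < ν + n + 1 := by linarith [(Nat.cast_nonneg n : (0 : ℝ) ≤ n)]
    have heq : (fun x => x * thetaGamma ν n x) =ᶠ[nhds t] fun x =>
        (n.factorial : ℝ) / Real.Gamma (1 + ν) *
          ∫ u in Ioi (0 : ℝ), Real.exp (-u) * u ^ (ν + n + 1 - 1) * (x / (x + u)) ^ (n + 1) := by
      filter_upwards [Ioi_mem_nhds ht] with x (hx : 0 < x)
      rw [ih hx, mul_left_comm, ← mul_assoc x, ← pow_succ', ← integral_const_mul]
      congr 1
      refine integral_congr_ae (Filter.Eventually.of_forall fun u => ?_)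
      simp only [div_pow]
      ring
    rw [hstep, thetaOp, heq.deriv_eq, ((hasDerivAt_stieltjes hs ht n).const_mul _).deriv,
      integral_const_mul, ← integral_const_mul (t ^ (n + 1)), mul_left_comm,
      ← mul_assoc t, mul_comm t, mul_assoc ((n : ℝ) + 1), ← integral_const_mul,
      Nat.factorial_succ, Nat.cast_mul, mul_comm (((n + 1 : ℕ) : ℝ)), mul_div_right_comm, mul_assoc]
    congr 1
    push_cast
    congr 1
    refine setIntegral_congr_fun measurableSet_Ioi fun u (hu : 0 < u) => ?_
    have e : u ^ (ν + (n + 1) + 1 - 1) = u ^ (ν + n + 1 - 1) * u := by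
      rw [← Real.rpow_add_one hu.ne']; ring_nf
    simp only [e, div_pow]
    field_simp
    ring

/-- The closed form of `∫₀^∞ x^k ρ_a(x) ρ_b(x) dx`; as a definition by gamma functions it turns the
identities between such integrals into algebra. -/
noncomputable def mixedMoment (k : ℕ) (a b : ℝ) : ℝ :=
  k.factorial * Real.Gamma (a + k + 1) * Real.Gamma (b + k + 1) * Real.Gamma (a + b + k + 1) /
    Real.Gamma (a + b + 2 * k + 2)

/-- The moments of `θⁿ {t^ν e^t Γ(-ν, t)}` for the gamma weight are mixed moments of the
weights `ρ`. -/
lemma integral_rpow_mul_thetaGamma {ν : ℝ} (hν : -1 / 2 < ν) (n j : ℕ) :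
    IntegrableOn (fun t : ℝ => t ^ (ν + j) * Real.exp (-t) * thetaGamma ν n t) (Ioi 0) ∧
      ∫ t in Ioi (0 : ℝ), t ^ (ν + j) * Real.exp (-t) * thetaGamma ν n t =
        mixedMoment n ν (ν + j) / Real.Gamma (1 + ν) := by
  have hn : (0 : ℝ) ≤ n := Nat.cast_nonneg n
  have hj : (0 : ℝ) ≤ j := Nat.cast_nonneg j
  have hΓ := Real.Gamma_pos_of_pos (show 0 < 1 + ν by linarith)
  have hp : 0 < ν + n + 1 := by linarith
  have hq : 0 < ν + j + n + 1 := by linarith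
  have hV : mixedMoment n ν (ν + j) / Real.Gamma (1 + ν) =
      n.factorial / Real.Gamma (1 + ν) * (Real.Gamma (ν + n + 1) * Real.Gamma (ν + j + n + 1) *
        Real.Gamma (ν + n + 1 + (ν + j + n + 1) - (n + 1 : ℕ)) /
          Real.Gamma (ν + n + 1 + (ν + j + n + 1))) := by
    rw [mixedMoment]
    push_cast
    rw [show ν + n + 1 + (ν + j + n + 1) - (n + 1) = ν + (ν + j) + n + 1 by ring,
      show ν + n + 1 + (ν + j + n + 1) = ν + (ν + j) + 2 * n + 2 by ring]
    ring
  have hN : ((n + 1 : ℕ) : ℝ) < ν + n + 1 + (ν + j + n + 1) := by push_cast; linarith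
  rw [hV]
  refine integrableOn_and_integral_eq_of_lintegral
    (h := fun t u => n.factorial / Real.Gamma (1 + ν) * (t ^ (ν + j + n + 1 - 1) * Real.exp (-t) *
      (Real.exp (-u) * u ^ (ν + n + 1 - 1) / (t + u) ^ (n + 1)))) ?_ ?_ ?_ ?_ ?_ ?_
  · have := Real.Gamma_pos_of_pos hp
    have := Real.Gamma_pos_of_pos hq
    have := Real.Gamma_pos_of_pos (add_pos hp hq)
    have := Real.Gamma_pos_of_pos (sub_pos.2 hN)
    positivity
  · unfold Function.uncurry; fun_prop
  · intro t ht
    exact ((integrableOn_exp_mul_rpow_div ht hp (n + 1)).const_mul _).const_mul _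
  · intro t ht u hu
    have := Real.rpow_pos_of_pos ht (ν + j + n + 1 - 1)
    have := Real.rpow_pos_of_pos hu (ν + n + 1 - 1)
    positivity
  · intro t ht
    rw [integral_const_mul, integral_const_mul, thetaGamma_eq (by linarith) n ht]
    have : t ^ (ν + j + n + 1 - 1) = t ^ (ν + j) * t ^ n := by
      rw [← Real.rpow_natCast, ← Real.rpow_add ht]; ring_nf
    rw [this]
    ring
  · have h0 : 0 ≤ (n.factorial : ℝ) / Real.Gamma (1 + ν) := by positivity
    rw [ENNReal.ofReal_mul h0, ← lintegral_lintegral_gamma_kernel hp hq (n + 1) hN,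
      ← lintegral_const_mul' _ _ ENNReal.ofReal_ne_top]
    refine lintegral_congr fun t => ?_
    rw [← lintegral_const_mul' _ _ ENNReal.ofReal_ne_top]
    exact lintegral_congr fun u => ENNReal.ofReal_mul h0

/-! ### The weight `ρ_ν` and the moments of its square -/

lemma integrableOn_rho_kernel {ν x : ℝ} (hν : 0 < ν + 1) (hx : 0 < x) :
    IntegrableOn (fun t : ℝ => t ^ (ν - 1) * Real.exp (-(t + x / t))) (Ioi 0) := by
  -- `e^{-y} ≤ 1 / y` at `y = x / t` gains the power of `t` that is missing at the origin.
  have h := (integrableOn_rpow_mul_exp_neg_mul hν one_pos).const_mul (1 / x)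
  refine Integrable.mono' h (Measurable.aestronglyMeasurable (by fun_prop))
    ((ae_restrict_mem measurableSet_Ioi).mono fun t (ht : 0 < t) => ?_)
  have ht' := Real.rpow_pos_of_pos ht (ν - 1)
  rw [Real.norm_of_nonneg (by positivity)]
  have h1 : Real.exp (-(x / t)) ≤ t / x := by
    rw [Real.exp_neg, inv_le_comm₀ (Real.exp_pos _) (by positivity), inv_div]
    linarith [Real.add_one_le_exp (x / t)]
  have h2 : t ^ (ν + 1 - 1) = t ^ (ν - 1) * t := by
    rw [← Real.rpow_add_one ht.ne']; ring_nf
  rw [neg_add, Real.exp_add, h2, one_mul]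
  calc t ^ (ν - 1) * (Real.exp (-t) * Real.exp (-(x / t)))
      ≤ t ^ (ν - 1) * (Real.exp (-t) * (t / x)) := by gcongr
    _ = _ := by ring

/-- The substitution `t = √x e^w` turns the integral of the Macdonald function into
`ρ_ν(x) = ∫₀^∞ t^{ν-1} e^{-t-x/t} dt`. -/
lemma rhoWeight_eq {ν x : ℝ} (hν : 0 < ν + 1) (hx : 0 < x) :
    rhoWeight ν x = ∫ t in Ioi (0 : ℝ), t ^ (ν - 1) * Real.exp (-(t + x / t)) := by
  have hs : 0 < Real.sqrt x := Real.sqrt_pos.2 hx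
  have hss : Real.sqrt x * Real.sqrt x = x := Real.mul_self_sqrt hx.le
  have himg : (fun w => Real.sqrt x * Real.exp w) '' univ = Ioi 0 := by
    rw [image_univ]
    ext y
    constructor
    · rintro ⟨w, rfl⟩
      exact mul_pos hs (Real.exp_pos w)
    · intro (hy : 0 < y)
      exact ⟨Real.log (y / Real.sqrt x), by
        simp only [Real.exp_log (div_pos hy hs)]; field_simp⟩
  have hd : ∀ w ∈ (univ : Set ℝ), HasDerivWithinAt (fun w => Real.sqrt x * Real.exp w)
      (Real.sqrt x * Real.exp w) univ w := fun w _ =>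
    ((Real.hasDerivAt_exp w).const_mul _).hasDerivWithinAt
  have hinj : InjOn (fun w => Real.sqrt x * Real.exp w) univ := fun a _ b _ h =>
    Real.exp_injective (mul_left_cancel₀ hs.ne' h)
  have hint := (integrableOn_image_iff_integrableOn_abs_deriv_smul MeasurableSet.univ hd hinj
    (fun t : ℝ => t ^ (ν - 1) * Real.exp (-(t + x / t)))).1
    (by rw [himg]; exact integrableOn_rho_kernel hν hx)
  have heq := integral_image_eq_integral_abs_deriv_smul MeasurableSet.univ hd hinj
    (fun t : ℝ => t ^ (ν - 1) * Real.exp (-(t + x / t)))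
  rw [himg] at heq
  have hφ : (fun w => |Real.sqrt x * Real.exp w| • ((Real.sqrt x * Real.exp w) ^ (ν - 1) *
      Real.exp (-(Real.sqrt x * Real.exp w + x / (Real.sqrt x * Real.exp w))))) =
      fun w => x ^ (ν / 2) *
        (Real.exp (-(2 * Real.sqrt x) * Real.cosh w) * Real.exp (ν * w)) := by
    funext w
    have hy : 0 < Real.sqrt x * Real.exp w := mul_pos hs (Real.exp_pos w)
    have e1 : (Real.sqrt x * Real.exp w) * (Real.sqrt x * Real.exp w) ^ (ν - 1) =
        x ^ (ν / 2) * Real.exp (ν * w) := by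
      rw [mul_comm (Real.sqrt x * Real.exp w), ← Real.rpow_add_one hy.ne', sub_add_cancel,
        Real.mul_rpow hs.le (Real.exp_pos w).le, Real.sqrt_eq_rpow, ← Real.rpow_mul hx.le,
        ← Real.exp_mul, mul_comm w]
      ring_nf
    have e2 : x / (Real.sqrt x * Real.exp w) = Real.sqrt x * Real.exp (-w) := by
      rw [Real.exp_neg]
      field_simp
      linarith
    rw [abs_of_pos hy, smul_eq_mul, ← mul_assoc, e1, e2, Real.cosh_eq]
    ring_nf
  rw [hφ] at heq hint
  rw [heq, rhoWeight, setIntegral_univ, integral_const_mul, macdonaldK]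
  have hφi : Integrable fun w =>
      Real.exp (-(2 * Real.sqrt x) * Real.cosh w) * Real.exp (ν * w) := by
    have := (integrableOn_univ.1 hint).const_mul (x ^ (ν / 2))⁻¹
    have hx' := Real.rpow_pos_of_pos hx (ν / 2)
    refine this.congr (Filter.Eventually.of_forall fun w => ?_)
    field_simp
  have hneg := integral_comp_neg_Ioi (0 : ℝ) fun w =>
      Real.exp (-(2 * Real.sqrt x) * Real.cosh w) * Real.exp (ν * w)
  rw [neg_zero] at hneg
  rw [← integral_add_compl (measurableSet_Ioi (a := (0 : ℝ))) hφi, compl_Ioi, ← hneg,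
    ← integral_add hφi.integrableOn hφi.comp_neg.integrableOn, mul_comm 2, mul_assoc,
    ← integral_const_mul]
  congr 1
  refine integral_congr_ae (Filter.Eventually.of_forall fun w => ?_)
  simp only [Real.cosh_neg, Real.cosh_eq (ν * w)]
  ring_nf

lemma rhoWeight_pos {ν x : ℝ} (hν : 0 < ν + 1) (hx : 0 < x) : 0 < rhoWeight ν x := by
  rw [rhoWeight_eq hν hx]
  refine (setIntegral_pos_iff_support_of_nonneg_ae
    ((ae_restrict_mem measurableSet_Ioi).mono fun t (ht : 0 < t) => ?_)
    (integrableOn_rho_kernel hν hx)).2 ?_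
  · have := Real.rpow_pos_of_pos ht (ν - 1)
    simp only [Pi.zero_apply]
    positivity
  · have : Function.support (fun t : ℝ => t ^ (ν - 1) * Real.exp (-(t + x / t))) ∩ Ioi 0 =
        Ioi 0 := by
      refine inter_eq_right.2 fun t (ht : 0 < t) => ?_
      have := Real.rpow_pos_of_pos ht (ν - 1)
      exact (by positivity : 0 < t ^ (ν - 1) * Real.exp (-(t + x / t))).ne'
    rw [this]
    simp

/-- The moments of `ρ_ν²`: the `x`-integral of a product of two kernels is a gamma integral, and
leaves the double integral `lintegral_lintegral_gamma_kernel`. -/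
lemma integral_pow_mul_rhoWeight_sq {ν : ℝ} (hν : -1 / 2 < ν) (k : ℕ) :
    IntegrableOn (fun x : ℝ => x ^ k * rhoWeight ν x ^ 2) (Ioi 0) ∧
      ∫ x in Ioi (0 : ℝ), x ^ k * rhoWeight ν x ^ 2 = mixedMoment k ν ν := by
  have hk : (0 : ℝ) ≤ k := Nat.cast_nonneg k
  have hν1 : 0 < ν + 1 := by linarith
  have hp : 0 < ν + k + 1 := by linarith
  have hN : ((k + 1 : ℕ) : ℝ) < ν + k + 1 + (ν + k + 1) := by push_cast; linarith
  have hV : mixedMoment k ν ν = k.factorial * (Real.Gamma (ν + k + 1) * Real.Gamma (ν + k + 1) *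
      Real.Gamma (ν + k + 1 + (ν + k + 1) - (k + 1 : ℕ)) /
        Real.Gamma (ν + k + 1 + (ν + k + 1))) := by
    rw [mixedMoment]
    push_cast
    rw [show ν + k + 1 + (ν + k + 1) - (k + 1) = ν + ν + k + 1 by ring,
      show ν + k + 1 + (ν + k + 1) = ν + ν + 2 * k + 2 by ring]
    ring
  set R : ℝ → ℝ → ℝ := fun x t => t ^ (ν - 1) * Real.exp (-(t + x / t)) with hR
  set r : ℝ → ℝ := fun x => ∫ t in Ioi (0 : ℝ), R x t with hr
  have hRm : Measurable (Function.uncurry R) := by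
    simp only [hR]; unfold Function.uncurry; fun_prop
  have hrm : Measurable r := hRm.stronglyMeasurable.integral_prod_right.measurable
  have hRpos : ∀ x t, 0 < t → 0 < R x t := fun x t ht => by
    have := Real.rpow_pos_of_pos ht (ν - 1)
    simp only [hR]
    positivity
  have hrx : ∀ x, 0 < x → rhoWeight ν x = r x := fun x hx => rhoWeight_eq hν1 hx
  have hr0 : ∀ x, 0 ≤ r x := fun x =>
    setIntegral_nonneg measurableSet_Ioi fun t ht => (hRpos x t ht).le
  have hrl : ∀ x, 0 < x → ENNReal.ofReal (r x) = ∫⁻ t in Ioi (0 : ℝ), ENNReal.ofReal (R x t) :=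
    fun x hx => ofReal_integral_eq_lintegral_ofReal (integrableOn_rho_kernel hν1 hx)
      ((ae_restrict_mem measurableSet_Ioi).mono fun t ht => (hRpos x t ht).le)
  rw [hV]
  refine integrableOn_and_integral_eq_of_lintegral (h := fun x u => x ^ k * r x * R x u)
    ?_ ?_ ?_ ?_ ?_ ?_
  · have := Real.Gamma_pos_of_pos hp
    have := Real.Gamma_pos_of_pos (add_pos hp hp)
    have := Real.Gamma_pos_of_pos (sub_pos.2 hN)
    positivity
  · exact ((measurable_fst.pow_const k).mul (hrm.comp measurable_fst)).mul hRm
  · exact fun x hx => (integrableOn_rho_kernel hν1 hx).const_mul _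
  · exact fun x hx u hu => mul_nonneg (mul_nonneg (pow_nonneg hx.le k) (hr0 x)) (hRpos x u hu).le
  · intro x hx
    rw [integral_const_mul, hrx x hx, sq, mul_assoc]
  · have h1 : ∀ x ∈ Ioi (0 : ℝ), ∫⁻ u in Ioi (0 : ℝ), ENNReal.ofReal (x ^ k * r x * R x u) =
        ∫⁻ u in Ioi (0 : ℝ), ∫⁻ t in Ioi (0 : ℝ),
          ENNReal.ofReal (x ^ k) * ENNReal.ofReal (R x u) * ENNReal.ofReal (R x t) := by
      intro x (hx : 0 < x)
      refine lintegral_congr fun u => ?_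
      rw [lintegral_const_mul _ (by simp only [hR]; fun_prop), ← hrl x hx,
        ENNReal.ofReal_mul (mul_nonneg (pow_nonneg hx.le k) (hr0 x)),
        ENNReal.ofReal_mul (pow_nonneg hx.le k)]
      ring
    rw [setLIntegral_congr_fun measurableSet_Ioi h1, lintegral_lintegral_swap ?_,
      ENNReal.ofReal_mul (by positivity), ← lintegral_lintegral_gamma_kernel hp hp (k + 1) hN,
      ← lintegral_const_mul' _ _ ENNReal.ofReal_ne_top]
    swap
    · refine Measurable.aemeasurable (Measurable.lintegral_prod_right' (f := fun z : (ℝ × ℝ) × ℝ =>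
        ENNReal.ofReal (z.1.1 ^ k) * ENNReal.ofReal (R z.1.1 z.1.2) *
          ENNReal.ofReal (R z.1.1 z.2)) ?_)
      simp only [hR]; fun_prop
    refine setLIntegral_congr_fun measurableSet_Ioi fun u (hu : 0 < u) => ?_
    have hu' := Real.rpow_pos_of_pos hu (ν - 1)
    rw [lintegral_lintegral_swap (by
        refine Measurable.aemeasurable ?_
        simp only [hR]; unfold Function.uncurry; fun_prop),
      ← lintegral_const_mul' _ _ ENNReal.ofReal_ne_top]
    refine setLIntegral_congr_fun measurableSet_Ioi fun t (ht : 0 < t) => ?_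
    have ht' := Real.rpow_pos_of_pos ht (ν - 1)
    have hc : 0 < u ^ (ν - 1) * Real.exp (-u) * (t ^ (ν - 1) * Real.exp (-t)) := by positivity
    have hut : 0 < (u + t) / (u * t) := by positivity
    have h2 : ∀ x ∈ Ioi (0 : ℝ),
        ENNReal.ofReal (x ^ k) * ENNReal.ofReal (R x u) * ENNReal.ofReal (R x t) =
        ENNReal.ofReal (u ^ (ν - 1) * Real.exp (-u) * (t ^ (ν - 1) * Real.exp (-t))) *
          ENNReal.ofReal (x ^ ((k : ℝ) + 1 - 1) * Real.exp (-((u + t) / (u * t) * x))) := by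
      intro x (hx : 0 < x)
      rw [← ENNReal.ofReal_mul (by positivity),
        ← ENNReal.ofReal_mul (mul_nonneg (by positivity) (hRpos x u hu).le),
        ← ENNReal.ofReal_mul hc.le, add_sub_cancel_right, Real.rpow_natCast]
      congr 1
      have : Real.exp (-(u + x / u)) * Real.exp (-(t + x / t)) =
          Real.exp (-u) * Real.exp (-t) * Real.exp (-((u + t) / (u * t) * x)) := by
        rw [← Real.exp_add, ← Real.exp_add, ← Real.exp_add]
        congr 1
        field_simp
        ring
      simp only [hR]
      linear_combination x ^ k * u ^ (ν - 1) * t ^ (ν - 1) * this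
    rw [setLIntegral_congr_fun measurableSet_Ioi h2, lintegral_const_mul _ (by fun_prop),
      lintegral_rpow_mul_exp_neg_mul (by positivity) hut, ← ENNReal.ofReal_mul hc.le,
      ← ENNReal.ofReal_mul (by positivity), Real.Gamma_nat_eq_factorial]
    congr 1
    have e : ∀ y : ℝ, 0 < y → y ^ (ν + k + 1 - 1) = y ^ (ν - 1) * y ^ (k + 1) := fun y hy => by
      rw [← Real.rpow_natCast, ← Real.rpow_add hy]; push_cast; ring_nf
    rw [e u hu, e t ht, one_div_div, ← Nat.cast_add_one, Real.rpow_natCast, div_pow, mul_pow]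
    ring

/-! ### Pochhammer symbols -/

lemma poch_zero (a : ℝ) : poch a 0 = 1 := by simp [poch]

lemma poch_succ (a : ℝ) (k : ℕ) : poch a (k + 1) = poch a k * (a + k) := by
  simp [poch, ascPochhammer_succ_right]

lemma poch_succ_left (a : ℝ) (k : ℕ) : poch a (k + 1) = a * poch (a + 1) k := by
  simp [poch, ascPochhammer_succ_left]

lemma poch_pos {a : ℝ} (ha : 0 < a) (k : ℕ) : 0 < poch a k := by
  induction k with
  | zero => simp [poch_zero]
  | succ k ih => rw [poch_succ]; positivity

lemma Gamma_add_natCast {a : ℝ} (ha : 0 < a) (k : ℕ) :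
    Real.Gamma (a + k) = poch a k * Real.Gamma a := by
  induction k with
  | zero => simp [poch_zero]
  | succ k ih =>
    rw [Nat.cast_add_one, ← add_assoc, Real.Gamma_add_one (by positivity), ih, poch_succ]
    ring

lemma poch_neg_natCast (r j : ℕ) : poch (-(r : ℝ)) j = (-1) ^ j * (r.descFactorial j : ℝ) := by
  induction j with
  | zero => simp [poch_zero]
  | succ j ih =>
    rw [poch_succ, ih, Nat.descFactorial_succ]
    rcases le_or_gt j r with h | h
    · rw [Nat.cast_mul, Nat.cast_sub h]; ring
    · rw [Nat.descFactorial_of_lt h]; simp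

lemma poch_natCast_add_one (m j : ℕ) :
    poch ((m : ℝ) + 1) j = ((m + j).factorial : ℝ) / m.factorial := by
  have h := Gamma_add_natCast (show (0 : ℝ) < m + 1 by positivity) j
  rw [Real.Gamma_nat_eq_factorial, show (m : ℝ) + 1 + j = ((m + j : ℕ) : ℝ) + 1 by push_cast; ring,
    Real.Gamma_nat_eq_factorial] at h
  rw [h]
  field_simp

/-- The series `₃F₂` with upper parameter `-r` terminates. -/
lemma hyp3F2_neg_natCast (r : ℕ) (a₂ a₃ b₁ b₂ : ℝ) :
    hyp3F2 (-(r : ℝ)) a₂ a₃ b₁ b₂ 1 = ∑ j ∈ Finset.range (r + 1),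
      (-1) ^ j * (r.choose j : ℝ) * (poch a₂ j * poch a₃ j / (poch b₁ j * poch b₂ j)) := by
  rw [hyp3F2, tsum_eq_sum (s := Finset.range (r + 1))]
  · refine Finset.sum_congr rfl fun j _ => ?_
    rw [poch_neg_natCast, Nat.descFactorial_eq_factorial_mul_choose, one_pow, mul_one]
    push_cast
    have : (j.factorial : ℝ) ≠ 0 := by positivity
    field_simp
  · intro j hj
    rw [Finset.mem_range, not_lt] at hj
    rw [poch_neg_natCast, Nat.descFactorial_of_lt (by omega)]
    simp

lemma fwdDiff_iter_poch (s r : ℕ) (y : ℝ) :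
    (fwdDiff (1 : ℝ))^[r] (fun x => poch x s) y =
      (s.descFactorial r : ℝ) * poch (y + r) (s - r) := by
  induction r generalizing y with
  | zero => simp
  | succ r ih =>
    rw [Function.iterate_succ_apply', fwdDiff, ih, ih, Nat.descFactorial_succ]
    rcases lt_or_ge r s with h | h
    · obtain ⟨e, rfl⟩ := Nat.exists_eq_add_of_lt h
      rw [show r + e + 1 - r = e + 1 by omega, show r + e + 1 - (r + 1) = e by omega, poch_succ,
        poch_succ_left (y + r)]
      push_cast
      rw [show y + 1 + r = y + r + 1 by ring, show y + (r + 1 : ℝ) = y + r + 1 by ring]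
      ring
    · rw [Nat.sub_eq_zero_of_le h, poch_zero, poch_zero]
      simp

/-! ### Laguerre expansions -/

/-- The coefficient of `t^j` in the Laguerre polynomial `L_r^ν`; it vanishes for `j > r`. -/
noncomputable def laguerreCoeff (ν : ℝ) (r j : ℕ) : ℝ :=
  (-1) ^ j * (r.choose j : ℝ) / r.factorial * poch (ν + j + 1) (r - j)

lemma laguerreL_eq (ν : ℝ) (r : ℕ) (t : ℝ) :
    laguerreL ν r t = ∑ j ∈ Finset.range (r + 1), laguerreCoeff ν r j * t ^ j := by
  refine Finset.sum_congr rfl fun j hj => ?_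
  have hj : j ≤ r := Nat.lt_succ_iff.1 (Finset.mem_range.1 hj)
  rw [laguerreCoeff, Nat.cast_choose ℝ hj, neg_pow]
  have : (r.factorial : ℝ) ≠ 0 := by positivity
  field_simp

lemma laguerreCoeff_eq_Gamma {ν : ℝ} (hν : 0 < ν + 1) {r j : ℕ} (hj : j ≤ r) :
    laguerreCoeff ν r j = (-1) ^ j * (r.choose j : ℝ) / r.factorial *
      (Real.Gamma (ν + r + 1) / Real.Gamma (ν + j + 1)) := by
  have h1 : 0 < ν + j + 1 := by linarith [(Nat.cast_nonneg j : (0 : ℝ) ≤ j)]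
  have h := Gamma_add_natCast h1 (r - j)
  rw [Nat.cast_sub hj, show ν + j + 1 + (r - j : ℝ) = ν + r + 1 by ring] at h
  rw [laguerreCoeff, h, mul_div_assoc _ (Real.Gamma _), div_self (Real.Gamma_pos_of_pos h1).ne',
    mul_one]

lemma integral_rpow_mul_laguerreL_mul {a : ℝ} {g : ℝ → ℝ} {v : ℕ → ℝ}
    (h : ∀ j : ℕ, IntegrableOn (fun t : ℝ => t ^ (a + j) * g t) (Ioi 0) ∧
      ∫ t in Ioi (0 : ℝ), t ^ (a + j) * g t = v j) (ν : ℝ) (r : ℕ) :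
    IntegrableOn (fun t : ℝ => t ^ a * laguerreL ν r t * g t) (Ioi 0) ∧
      ∫ t in Ioi (0 : ℝ), t ^ a * laguerreL ν r t * g t =
        ∑ j ∈ Finset.range (r + 1), laguerreCoeff ν r j * v j := by
  have heq : EqOn (fun t : ℝ => t ^ a * laguerreL ν r t * g t)
      (fun t => ∑ j ∈ Finset.range (r + 1), laguerreCoeff ν r j * (t ^ (a + j) * g t))
      (Ioi 0) := by
    intro t (ht : 0 < t)
    simp only [laguerreL_eq, Finset.mul_sum, Finset.sum_mul]
    refine Finset.sum_congr rfl fun j _ => ?_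
    rw [Real.rpow_add ht, Real.rpow_natCast]
    ring
  have hi : ∀ j ∈ Finset.range (r + 1), Integrable
      (fun t : ℝ => laguerreCoeff ν r j * (t ^ (a + j) * g t)) (volume.restrict (Ioi 0)) :=
    fun j _ => (h j).1.const_mul _
  refine ⟨IntegrableOn.congr_fun (integrable_finsetSum _ hi) heq.symm measurableSet_Ioi, ?_⟩
  rw [setIntegral_congr_fun measurableSet_Ioi heq, integral_finsetSum _ hi]
  exact Finset.sum_congr rfl fun j _ => by rw [integral_const_mul, (h j).2]

/-- The Chu–Vandermonde sum, as the `r`-th difference of a polynomial `(x)_s`. -/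
lemma sum_laguerreCoeff_mul_Gamma {ν : ℝ} (hν : 0 < ν + 1) (r s : ℕ) :
    ∑ j ∈ Finset.range (r + 1), laguerreCoeff ν r j * Real.Gamma (ν + s + j + 1) =
      (-1) ^ r * (s.choose r : ℝ) * Real.Gamma (ν + s + 1) := by
  have hterm : ∀ j ∈ Finset.range (r + 1),
      laguerreCoeff ν r j * Real.Gamma (ν + s + j + 1) =
      (-1) ^ r * Real.Gamma (ν + r + 1) / r.factorial *
        (((-1 : ℤ) ^ (r - j) * r.choose j) • poch (ν + 1 + j • (1 : ℝ)) s) := by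
    intro j hj
    have hj : j ≤ r := Nat.lt_succ_iff.1 (Finset.mem_range.1 hj)
    have h1 : 0 < ν + j + 1 := by linarith [(Nat.cast_nonneg j : (0 : ℝ) ≤ j)]
    have hg := Real.Gamma_pos_of_pos h1
    have h := Gamma_add_natCast h1 s
    have hsign : (-1 : ℝ) ^ r * (-1) ^ (r - j) = (-1) ^ j := by
      obtain ⟨e, rfl⟩ := Nat.exists_eq_add_of_le hj
      rw [Nat.add_sub_cancel_left, pow_add, mul_assoc, ← mul_pow]
      norm_num
    rw [laguerreCoeff_eq_Gamma hν hj, show ν + s + j + 1 = ν + j + 1 + s by ring, h, zsmul_eq_mul,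
      ← hsign, nsmul_eq_mul, mul_one, show ν + 1 + j = ν + j + 1 by ring]
    push_cast
    field_simp
  rw [Finset.sum_congr rfl hterm, ← Finset.mul_sum,
    ← fwdDiff_iter_eq_sum_shift (1 : ℝ) (fun x => poch x s) r (ν + 1), fwdDiff_iter_poch]
  have hf : (r.factorial : ℝ) ≠ 0 := by positivity
  rcases le_or_gt r s with h | h
  · have h1 : 0 < ν + 1 + r := by linarith [(Nat.cast_nonneg r : (0 : ℝ) ≤ r)]
    have hG := Gamma_add_natCast h1 (s - r)
    rw [Nat.cast_sub h, show ν + 1 + r + (s - r : ℝ) = ν + s + 1 by ring,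
      show Real.Gamma (ν + 1 + r) = Real.Gamma (ν + r + 1) by ring_nf] at hG
    rw [hG, Nat.descFactorial_eq_factorial_mul_choose]
    push_cast
    field_simp
  · rw [Nat.descFactorial_of_lt h, Nat.choose_eq_zero_of_lt h]
    simp

/-- The Laguerre moments; for `s < r` this is the orthogonality of `L_r^ν` to `t^s`. -/
lemma integral_rpow_mul_exp_mul_laguerreL {ν : ℝ} (hν : 0 < ν + 1) (r s : ℕ) :
    IntegrableOn (fun t : ℝ => t ^ (ν + s) * (Real.exp (-t) * laguerreL ν r t)) (Ioi 0) ∧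
      ∫ t in Ioi (0 : ℝ), t ^ (ν + s) * (Real.exp (-t) * laguerreL ν r t) =
        (-1) ^ r * (s.choose r : ℝ) * Real.Gamma (ν + s + 1) := by
  rw [← sum_laguerreCoeff_mul_Gamma hν]
  have := integral_rpow_mul_laguerreL_mul (a := ν + s) (g := fun t => Real.exp (-t))
    (v := fun j => Real.Gamma (ν + s + j + 1)) (fun j => by
      have hp : 0 < ν + s + j + 1 := by
        linarith [(Nat.cast_nonneg j : (0 : ℝ) ≤ j), (Nat.cast_nonneg s : (0 : ℝ) ≤ s)]
      have h1 := integrableOn_rpow_mul_exp_neg_mul hp one_pos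
      have h2 := Real.integral_rpow_mul_exp_neg_mul_Ioi hp one_pos
      simp only [add_sub_cancel_right, one_mul, div_one, Real.one_rpow] at h1 h2
      exact ⟨h1, h2⟩) ν r
  simpa only [mul_assoc, mul_comm (laguerreL ν r _)] using this

lemma integral_laguerreL_mul_laguerreL {ν : ℝ} (hν : 0 < ν + 1) (m r : ℕ) :
    IntegrableOn
        (fun t : ℝ => t ^ (ν + m) * Real.exp (-t) * laguerreL ν m t * laguerreL ν r t) (Ioi 0) ∧
      coeffD ν m r = ∑ j ∈ Finset.range (r + 1), laguerreCoeff ν r j *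
        ((-1) ^ m * ((m + j).choose m : ℝ) * Real.Gamma (ν + m + j + 1)) := by
  have := integral_rpow_mul_laguerreL_mul (a := ν + m)
    (g := fun t => Real.exp (-t) * laguerreL ν m t)
    (v := fun j => (-1) ^ m * ((m + j).choose m : ℝ) * Real.Gamma (ν + m + j + 1)) (fun j => by
      have := integral_rpow_mul_exp_mul_laguerreL hν m (m + j)
      push_cast at this
      rwa [← add_assoc] at this) ν r
  have e : (fun t : ℝ => t ^ (ν + m) * Real.exp (-t) * laguerreL ν m t * laguerreL ν r t) =
      fun t => t ^ (ν + m) * laguerreL ν r t * (Real.exp (-t) * laguerreL ν m t) := by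
    funext t; ring
  rw [coeffD, e]
  exact this

/-- The expansion of `coeffD` along the coefficients of `L_m^ν` in place of those of `L_r^ν`. -/
lemma coeffD_eq_sum {ν : ℝ} (hν : 0 < ν + 1) (m r : ℕ) :
    coeffD ν m r = ∑ i ∈ Finset.range (m + 1), laguerreCoeff ν m i *
      ((-1) ^ r * ((m + i).choose r : ℝ) * Real.Gamma (ν + m + i + 1)) := by
  have := integral_rpow_mul_laguerreL_mul (a := ν + m)
    (g := fun t => Real.exp (-t) * laguerreL ν r t)
    (v := fun i => (-1) ^ r * ((m + i).choose r : ℝ) * Real.Gamma (ν + m + i + 1)) (fun i => by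
      have := integral_rpow_mul_exp_mul_laguerreL hν r (m + i)
      push_cast at this
      rwa [← add_assoc] at this) ν m
  rw [coeffD, ← this.2]
  congr 1
  funext t
  ring

lemma integral_laguerreL_mul_thetaGamma {ν : ℝ} (hν : -1 / 2 < ν) (n r : ℕ) :
    IntegrableOn
        (fun t : ℝ => t ^ ν * Real.exp (-t) * laguerreL ν r t * thetaGamma ν n t) (Ioi 0) ∧
      coeffC ν n r = (r.factorial : ℝ) / Real.Gamma (1 + ν + r) *
        ∑ j ∈ Finset.range (r + 1), laguerreCoeff ν r j *
          (mixedMoment n ν (ν + j) / Real.Gamma (1 + ν)) := by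
  have := integral_rpow_mul_laguerreL_mul (a := ν)
    (g := fun t => Real.exp (-t) * thetaGamma ν n t)
    (v := fun j => mixedMoment n ν (ν + j) / Real.Gamma (1 + ν)) (fun j => by
      simpa only [mul_assoc] using integral_rpow_mul_thetaGamma hν n j) ν r
  have e : (fun t : ℝ => t ^ ν * Real.exp (-t) * laguerreL ν r t * thetaGamma ν n t) =
      fun t => t ^ ν * laguerreL ν r t * (Real.exp (-t) * thetaGamma ν n t) := by
    funext t; ring
  rw [coeffC, e]
  exact ⟨this.1, by rw [this.2]⟩

lemma coeffC_eq_hyp3F2 {ν : ℝ} (hν : -1 / 2 < ν) (n r : ℕ) :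
    coeffC ν n r = (n.factorial : ℝ) * poch (1 + ν) n ^ 2 *
      (Real.Gamma (2 * ν + n + 1) / Real.Gamma (2 * ν + 2 * n + 2)) *
      hyp3F2 (-(r : ℝ)) (ν + n + 1) (2 * ν + n + 1) (1 + ν) (2 * ν + 2 * n + 2) 1 := by
  have hn : (0 : ℝ) ≤ n := Nat.cast_nonneg n
  rw [(integral_laguerreL_mul_thetaGamma hν n r).2, hyp3F2_neg_natCast, Finset.mul_sum,
    Finset.mul_sum]
  refine Finset.sum_congr rfl fun j hj => ?_
  have hj : j ≤ r := Nat.lt_succ_iff.1 (Finset.mem_range.1 hj)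
  have p1 : 0 < 1 + ν := by linarith
  have p2 : 0 < ν + n + 1 := by linarith
  have p3 : 0 < 2 * ν + n + 1 := by linarith
  have p4 : 0 < 2 * ν + 2 * n + 2 := by linarith
  have g0 : 0 < Real.Gamma (ν + r + 1) :=
    Real.Gamma_pos_of_pos (by linarith [(Nat.cast_nonneg r : (0 : ℝ) ≤ r)])
  have g1 := Real.Gamma_pos_of_pos p1
  have g3 := Real.Gamma_pos_of_pos p3
  have g4 := Real.Gamma_pos_of_pos p4
  have q1 := poch_pos p1 j
  have q4 := poch_pos p4 j
  rw [laguerreCoeff_eq_Gamma (by linarith) hj, mixedMoment,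
    show 1 + ν + r = ν + r + 1 by ring,
    show ν + j + 1 = 1 + ν + j by ring, Gamma_add_natCast p1 j,
    show ν + j + n + 1 = ν + n + 1 + j by ring, Gamma_add_natCast p2 j,
    show ν + n + 1 = 1 + ν + n by ring, Gamma_add_natCast p1 n,
    show ν + (ν + j) + n + 1 = 2 * ν + n + 1 + j by ring, Gamma_add_natCast p3 j,
    show ν + (ν + j) + 2 * n + 2 = 2 * ν + 2 * n + 2 + j by ring, Gamma_add_natCast p4 j]
  have hf : (r.factorial : ℝ) ≠ 0 := by positivity
  field_simp

lemma coeffD_eq_hyp3F2 {ν : ℝ} (hν : 0 < ν + 1) (m r : ℕ) :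
    coeffD ν m r = (-1) ^ m / (r.factorial : ℝ) * poch (1 + ν) r * Real.Gamma (1 + ν + m) *
      hyp3F2 (-(r : ℝ)) (ν + m + 1) (m + 1) (1 + ν) 1 1 := by
  have hm : (0 : ℝ) ≤ m := Nat.cast_nonneg m
  rw [(integral_laguerreL_mul_laguerreL hν m r).2, hyp3F2_neg_natCast, Finset.mul_sum]
  refine Finset.sum_congr rfl fun j hj => ?_
  have hj : j ≤ r := Nat.lt_succ_iff.1 (Finset.mem_range.1 hj)
  have p1 : 0 < 1 + ν := by linarith
  have p2 : 0 < ν + m + 1 := by linarith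
  have g1 := Real.Gamma_pos_of_pos p1
  have q1 := poch_pos p1 j
  have h1 := poch_natCast_add_one 0 j
  simp only [Nat.cast_zero, zero_add, Nat.factorial_zero, Nat.cast_one, div_one] at h1
  rw [laguerreCoeff_eq_Gamma hν hj, h1, poch_natCast_add_one, Nat.choose_symm_add, Nat.add_choose, Nat.cast_div
      (Nat.factorial_mul_factorial_dvd_factorial_add m j) (by positivity),
    show ν + r + 1 = 1 + ν + r by ring, Gamma_add_natCast p1 r,
    show ν + j + 1 = 1 + ν + j by ring, Gamma_add_natCast p1 j,
    show ν + m + j + 1 = ν + m + 1 + j by ring, Gamma_add_natCast p2 j,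
    show 1 + ν + m = ν + m + 1 by ring]
  push_cast
  have hf : (r.factorial : ℝ) ≠ 0 := by positivity
  field_simp

/-! ### The numbers `f_{k,m}` are scaled moments -/

lemma sum_alternating_choose_mul_choose {N s : ℕ} (hs : s ≤ N) (j : ℕ) :
    ∑ r ∈ Finset.range (N + 1), (-1 : ℝ) ^ r * (s.choose r : ℝ) * (r.choose j : ℝ) =
      if j = s then (-1) ^ j else 0 := by
  rcases lt_or_ge s j with h | h
  · rw [if_neg (by omega)]
    refine Finset.sum_eq_zero fun r _ => ?_
    rcases lt_or_ge s r with h1 | h1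
    · simp [Nat.choose_eq_zero_of_lt h1]
    · simp [Nat.choose_eq_zero_of_lt (h1.trans_lt h)]
  · have hsub : ∑ r ∈ Finset.range (N + 1), (-1 : ℝ) ^ r * (s.choose r : ℝ) * (r.choose j : ℝ) =
        ∑ r ∈ Finset.Ico j (s + 1), (-1 : ℝ) ^ r * (s.choose r : ℝ) * (r.choose j : ℝ) := by
      refine (Finset.sum_subset (fun r hr => ?_) fun r _ hr => ?_).symm
      · simp only [Finset.mem_Ico, Finset.mem_range] at hr ⊢; omega
      · rw [Finset.mem_Ico, not_and_or, not_le, not_lt] at hr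
        rcases hr with hr | hr
        · simp [Nat.choose_eq_zero_of_lt hr]
        · simp [Nat.choose_eq_zero_of_lt (show s < r by omega)]
    have halt : ∑ i ∈ Finset.range (s - j + 1), (-1 : ℝ) ^ i * ((s - j).choose i : ℝ) =
        if s - j = 0 then 1 else 0 := by
      have := congrArg (Int.cast : ℤ → ℝ) (Int.alternating_sum_range_choose (n := s - j))
      push_cast at this
      exact this
    rw [hsub, Finset.sum_Ico_eq_sum_range, show s + 1 - j = s - j + 1 by omega]
    have : ∀ i ∈ Finset.range (s - j + 1),
        (-1 : ℝ) ^ (j + i) * (s.choose (j + i) : ℝ) * ((j + i).choose j : ℝ) =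
        (-1) ^ j * (s.choose j : ℝ) * ((-1) ^ i * ((s - j).choose i : ℝ)) := by
      intro i _
      have h := Nat.choose_mul (n := s) (Nat.le_add_right j i)
      rw [Nat.add_sub_cancel_left] at h
      have h' : (s.choose (j + i) : ℝ) * ((j + i).choose j : ℝ) =
          (s.choose j : ℝ) * ((s - j).choose i : ℝ) := by exact_mod_cast h
      rw [mul_assoc, h', pow_add]
      ring
    rw [Finset.sum_congr rfl this, ← Finset.mul_sum, halt]
    rcases eq_or_ne j s with rfl | hne
    · simp
    · rw [if_neg (by omega), if_neg hne, mul_zero]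

/-- Parseval's identity for the Laguerre system: binomial inversion recovers a moment `G s` from the
Laguerre coefficients of the sequence `G` of moments. -/
lemma sum_choose_mul_laguerreCoeff {ν : ℝ} (hν : 0 < ν + 1) (G : ℕ → ℝ) {N s : ℕ} (hs : s ≤ N) :
    ∑ r ∈ Finset.range (N + 1), (r.factorial : ℝ) / Real.Gamma (1 + ν + r) *
      (∑ j ∈ Finset.range (r + 1), laguerreCoeff ν r j * G j) *
        ((-1) ^ r * (s.choose r : ℝ) * Real.Gamma (ν + s + 1)) = G s := by
  have hg : ∀ j : ℕ, 0 < Real.Gamma (ν + j + 1) := fun j =>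
    Real.Gamma_pos_of_pos (by linarith [(Nat.cast_nonneg j : (0 : ℝ) ≤ j)])
  have h1 : ∀ r ∈ Finset.range (N + 1), (r.factorial : ℝ) / Real.Gamma (1 + ν + r) *
      (∑ j ∈ Finset.range (r + 1), laguerreCoeff ν r j * G j) *
        ((-1) ^ r * (s.choose r : ℝ) * Real.Gamma (ν + s + 1)) =
      ∑ j ∈ Finset.range (N + 1), ((-1) ^ r * (s.choose r : ℝ) * (r.choose j : ℝ)) *
        ((-1) ^ j * G j * Real.Gamma (ν + s + 1) / Real.Gamma (ν + j + 1)) := by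
    intro r hr
    have hsub : ∑ j ∈ Finset.range (r + 1), laguerreCoeff ν r j * G j =
        ∑ j ∈ Finset.range (N + 1), (-1) ^ j * (r.choose j : ℝ) / r.factorial *
          (Real.Gamma (ν + r + 1) / Real.Gamma (ν + j + 1)) * G j := by
      rw [Finset.sum_congr rfl fun j hj => by
        rw [laguerreCoeff_eq_Gamma hν (Nat.lt_succ_iff.1 (Finset.mem_range.1 hj))]]
      refine Finset.sum_subset (fun j hj => ?_) fun j _ hj => ?_
      · simp only [Finset.mem_range] at hj hr ⊢; omega
      · rw [Finset.mem_range, not_lt] at hj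
        simp [Nat.choose_eq_zero_of_lt (show r < j by omega)]
    rw [hsub, Finset.mul_sum, Finset.sum_mul]
    refine Finset.sum_congr rfl fun j _ => ?_
    have := hg r
    have := hg j
    have hf : (r.factorial : ℝ) ≠ 0 := by positivity
    rw [show 1 + ν + r = ν + r + 1 by ring]
    field_simp
  rw [Finset.sum_congr rfl h1, Finset.sum_comm]
  simp only [← Finset.sum_mul, sum_alternating_choose_mul_choose hs]
  rw [Finset.sum_eq_single s]
  · have := hg s
    rw [if_pos rfl]
    field_simp
    rw [← pow_mul, mul_comm s, pow_mul]
    simp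
  · intro j _ hj
    rw [if_neg hj, zero_mul]
  · intro h
    exact absurd (Finset.mem_range.2 (Nat.lt_succ_of_le hs)) h

/-- The moment form of the recurrence `x ρ_b = ρ_{b+2} - (b+1) ρ_{b+1}`. -/
lemma mixedMoment_succ {a b : ℝ} (ha : -1 / 2 < a) (hb : -1 / 2 < b) (k : ℕ) :
    mixedMoment (k + 1) a b = mixedMoment k a (b + 2) - (b + 1) * mixedMoment k a (b + 1) := by
  have hk : (0 : ℝ) ≤ k := Nat.cast_nonneg k
  have p1 : 0 < a + k + 1 := by linarith
  have p2 : 0 < b + k + 2 := by linarith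
  have p3 : 0 < a + b + k + 2 := by linarith
  have p4 : 0 < a + b + 2 * k + 3 := by linarith
  have g := Real.Gamma_pos_of_pos p4
  simp only [mixedMoment, Nat.cast_add_one, Nat.factorial_succ, Nat.cast_mul]
  rw [show a + (k + 1 : ℝ) + 1 = a + k + 1 + 1 by ring,
    show b + (k + 1 : ℝ) + 1 = b + k + 2 by ring,
    show a + b + (k + 1 : ℝ) + 1 = a + b + k + 2 by ring,
    show a + b + 2 * (k + 1 : ℝ) + 2 = a + b + 2 * k + 3 + 1 by ring,
    show b + 2 + k + 1 = b + k + 2 + 1 by ring,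
    show a + (b + 2) + k + 1 = a + b + k + 2 + 1 by ring,
    show a + (b + 2) + 2 * k + 2 = a + b + 2 * k + 3 + 1 by ring,
    show b + 1 + k + 1 = b + k + 2 by ring,
    show a + (b + 1) + k + 1 = a + b + k + 2 by ring,
    show a + (b + 1) + 2 * k + 2 = a + b + 2 * k + 3 by ring,
    Real.Gamma_add_one p1.ne', Real.Gamma_add_one p2.ne', Real.Gamma_add_one p3.ne',
    Real.Gamma_add_one p4.ne']
  generalize hq : a + b + 2 * k + 3 = q at *
  field_simp
  rw [← hq]
  ring

lemma laguerreCoeff_succ_zero (ν : ℝ) (m : ℕ) :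
    ((m : ℝ) + 1) * laguerreCoeff ν (m + 1) 0 = (ν + m + 1) * laguerreCoeff ν m 0 := by
  simp only [laguerreCoeff, Nat.sub_zero, poch_succ, Nat.factorial_succ, Nat.cast_mul,
    Nat.cast_add_one, Nat.choose_zero_right, Nat.cast_zero]
  have hf : (m.factorial : ℝ) ≠ 0 := by positivity
  have hm : (m : ℝ) + 1 ≠ 0 := by positivity
  field_simp
  ring

lemma laguerreCoeff_succ_succ (ν : ℝ) {m i : ℕ} (hi : i ≤ m) :
    ((m : ℝ) + 1) * laguerreCoeff ν (m + 1) (i + 1) =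
      (ν + m + i + 2) * laguerreCoeff ν m (i + 1) - laguerreCoeff ν m i := by
  obtain ⟨e, rfl⟩ := Nat.exists_eq_add_of_le hi
  have hf : ((i + e).factorial : ℝ) ≠ 0 := by positivity
  have hm : ((i + e : ℕ) : ℝ) + 1 ≠ 0 := by positivity
  have hsym : ((i + e).choose (i + 1) : ℝ) * (i + 1) = ((i + e).choose i : ℝ) * e := by
    have := Nat.choose_succ_right_eq (i + e) i
    rw [Nat.add_sub_cancel_left] at this
    exact_mod_cast this
  have hpas : ((i + e + 1).choose (i + 1) : ℝ) =
      ((i + e).choose i : ℝ) + ((i + e).choose (i + 1) : ℝ) := by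
    exact_mod_cast Nat.choose_succ_succ' (i + e) i
  simp only [laguerreCoeff, show i + e + 1 - (i + 1) = e by omega, Nat.add_sub_cancel_left,
    Nat.factorial_succ, Nat.cast_mul, hpas]
  cases e with
  | zero =>
    simp only [Nat.add_zero, Nat.choose_self, poch_zero, Nat.choose_succ_self] at *
    push_cast
    field_simp
    ring
  | succ e =>
    rw [show i + (e + 1) - (i + 1) = e by omega, poch_succ, poch_succ_left (ν + i + 1)]
    push_cast at *
    rw [show ν + (i + 1 : ℝ) + 1 = ν + i + 1 + 1 by ring]
    field_simp
    linear_combination (-1) ^ i * poch (ν + i + 1 + 1) e * hsym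

/-- The moment form of the identity
`∫₀^∞ t^{ν+m-1} e^{-t-x/t} L_m^ν(t) dt = (-1)^m x^m ρ_ν(x) / m!`. -/
lemma sum_laguerreCoeff_mul_mixedMoment {a b : ℝ} (ha : -1 / 2 < a) (hb : -1 / 2 < b) (m k : ℕ) :
    ∑ i ∈ Finset.range (m + 1), laguerreCoeff b m i * mixedMoment k a (b + (m + i : ℕ)) =
      (-1) ^ m / m.factorial * mixedMoment (k + m) a b := by
  induction m generalizing k with
  | zero => simp [laguerreCoeff, poch_zero]
  | succ m ih =>
    set M : ℕ → ℝ := fun i => mixedMoment k a (b + (m + 1 + i : ℕ)) with hM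
    have hm : (m : ℝ) + 1 ≠ 0 := by positivity
    have h1 := ih (k + 1)
    have h2 : ∀ i : ℕ, mixedMoment (k + 1) a (b + (m + i : ℕ)) =
        M (i + 1) - (b + m + i + 1) * M i := by
      intro i
      rw [mixedMoment_succ ha (by linarith [(Nat.cast_nonneg (m + i) : (0 : ℝ) ≤ (m + i : ℕ))])]
      simp only [hM]
      push_cast
      ring_nf
    have hlast : laguerreCoeff b m (m + 1) = 0 := by simp [laguerreCoeff]
    have h3 : ((m : ℝ) + 1) * ∑ i ∈ Finset.range (m + 1 + 1), laguerreCoeff b (m + 1) i * M i =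
        -∑ i ∈ Finset.range (m + 1),
          laguerreCoeff b m i * mixedMoment (k + 1) a (b + (m + i : ℕ)) := by
      have hS := Finset.sum_range_succ' (fun i => (b + m + i + 1) * laguerreCoeff b m i * M i)
        (m + 1)
      rw [Finset.sum_range_succ, hlast] at hS
      rw [Finset.sum_range_succ', mul_add, Finset.mul_sum, ← mul_assoc, laguerreCoeff_succ_zero]
      rw [Finset.sum_congr rfl fun i hi => by
        rw [← mul_assoc,
          laguerreCoeff_succ_succ b (Nat.lt_succ_iff.1 (Finset.mem_range.1 hi)), sub_mul]]
      rw [Finset.sum_sub_distrib]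
      simp only [h2, mul_sub, Finset.sum_sub_distrib]
      push_cast at hS
      have e1 : ∀ i : ℕ, (b + m + i + 2) * laguerreCoeff b m (i + 1) * M (i + 1) =
          (b + m + (i + 1) + 1) * laguerreCoeff b m (i + 1) * M (i + 1) := fun i => by ring
      have e2 : ∀ i : ℕ, laguerreCoeff b m i * ((b + m + i + 1) * M i) =
          (b + m + i + 1) * laguerreCoeff b m i * M i := fun i => by ring
      simp only [e1, e2]
      linear_combination -hS
    rw [h1] at h3
    rw [← mul_right_inj' hm, h3, show k + (m + 1) = k + 1 + m by ring, Nat.factorial_succ,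
      pow_succ]
    push_cast
    field_simp

/-- The entries of the determinants are the moments of `ρ_ν²`, with a factor that depends only on
the row. -/
lemma coeffF_eq {ν : ℝ} (hν : -1 / 2 < ν) (k m : ℕ) :
    coeffF ν k m =
      (-1) ^ m / (m.factorial * Real.Gamma (1 + ν)) * mixedMoment (k + m) ν ν := by
  have hν1 : 0 < ν + 1 := by linarith
  have h := sum_laguerreCoeff_mul_mixedMoment hν hν m k
  set G : ℕ → ℝ := fun j => mixedMoment k ν (ν + j) / Real.Gamma (1 + ν) with hG
  have hF : coeffF ν k m = ∑ i ∈ Finset.range (m + 1), laguerreCoeff ν m i * G (m + i) := by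
    have h1 : ∀ r ∈ Finset.range (2 * m + 1), coeffC ν k r * coeffD ν m r =
        ∑ i ∈ Finset.range (m + 1), laguerreCoeff ν m i *
          ((r.factorial : ℝ) / Real.Gamma (1 + ν + r) *
            (∑ j ∈ Finset.range (r + 1), laguerreCoeff ν r j * G j) *
              ((-1) ^ r * ((m + i).choose r : ℝ) * Real.Gamma (ν + (m + i : ℕ) + 1))) := by
      intro r _
      rw [(integral_laguerreL_mul_thetaGamma hν k r).2, coeffD_eq_sum hν1, Finset.mul_sum]
      refine Finset.sum_congr rfl fun i _ => ?_
      push_cast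
      rw [← add_assoc]
      ring
    rw [coeffF, Finset.sum_congr rfl h1, Finset.sum_comm]
    refine Finset.sum_congr rfl fun i hi => ?_
    rw [Finset.mem_range] at hi
    rw [← Finset.mul_sum, sum_choose_mul_laguerreCoeff hν1 G (by omega)]
  rw [hF]
  simp only [hG, ← mul_div_assoc, ← Finset.sum_div]
  rw [h]
  have := Real.Gamma_pos_of_pos (show 0 < 1 + ν by linarith)
  field_simp

/-! ### Orthogonality with respect to a positive functional on polynomials -/

lemma map_mul_eq_zero_of_degree_lt {L : ℝ[X] →ₗ[ℝ] ℝ} {R : ℝ[X]} {n : ℕ}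
    (hR : ∀ m < n, L (R * X ^ m) = 0) {q : ℝ[X]} (hq : q.degree < n) : L (R * q) = 0 := by
  rcases eq_or_ne q 0 with rfl | h0
  · rw [mul_zero, map_zero]
  rw [q.as_sum_range' n ((natDegree_lt_iff_degree_lt h0).2 hq), Finset.mul_sum, map_sum]
  refine Finset.sum_eq_zero fun m hm => ?_
  rw [← C_mul_X_pow_eq_monomial, mul_left_comm, ← smul_eq_C_mul, map_smul,
    hR m (Finset.mem_range.1 hm), smul_zero]

lemma eq_zero_of_forall_map_mul_X_pow {L : ℝ[X] →ₗ[ℝ] ℝ} (hL : ∀ p, p ≠ 0 → 0 < L (p * p))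
    {R : ℝ[X]} {n : ℕ} (hdeg : R.degree < n) (hR : ∀ m < n, L (R * X ^ m) = 0) : R = 0 := by
  by_contra h
  exact (hL R h).ne' (map_mul_eq_zero_of_degree_lt hR hdeg)

/-- A polynomial of degree at most `n` without constant term, orthogonal to all lower degrees,
vanishes: its quotient by `X` is orthogonal to itself for the functional `p ↦ L (X p)`. -/
lemma eq_zero_of_coeff_zero_of_forall_map_mul_X_pow {L : ℝ[X] →ₗ[ℝ] ℝ}
    (hL : ∀ p, p ≠ 0 → 0 < L (X * (p * p))) {R : ℝ[X]} {n : ℕ} (hdeg : R.degree < (n + 1 : ℕ))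
    (h0 : R.coeff 0 = 0) (hR : ∀ m < n, L (R * X ^ m) = 0) : R = 0 := by
  have hX : X * R.divX = R := by
    have := R.divX_mul_X_add
    rw [h0, C_0, add_zero] at this
    rw [mul_comm, this]
  have hq : R.divX.degree < n := by
    rw [degree_lt_iff_coeff_zero] at hdeg ⊢
    intro m hm
    rw [coeff_divX]
    exact hdeg _ (by omega)
  by_contra h
  have hne : R.divX ≠ 0 := fun h' => h (by rw [← hX, h', mul_zero])
  have := map_mul_eq_zero_of_degree_lt hR hq
  nth_rewrite 1 [← hX] at this
  rw [mul_assoc] at this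
  exact (hL _ hne).ne' this

lemma degree_sub_C_mul_lt {P q : ℝ[X]} {N : ℕ} (hP : P.degree = N)
    (hq : q.degree < (N + 1 : ℕ)) : (q - C (q.coeff N / P.coeff N) * P).degree < N := by
  have hP' : P.degree < (N + 1 : ℕ) := by rw [hP]; exact_mod_cast Nat.lt_succ_self N
  rw [degree_lt_iff_coeff_zero] at *
  intro m hm
  rw [coeff_sub, coeff_C_mul]
  rcases hm.eq_or_lt with rfl | hm
  · rw [div_mul_cancel₀ _ (coeff_ne_zero_of_eq_degree hP), sub_self]
  · rw [hq m hm, hP' m hm, mul_zero, sub_zero]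

section Sequence

variable {L : ℝ[X] →ₗ[ℝ] ℝ} {P : ℕ → ℝ[X]}

lemma map_mul_eq_zero_of_orthonormal (hdeg : ∀ n, (P n).degree = n)
    (hP : ∀ n m, L (P m * P n) = if n = m then 1 else 0) {n : ℕ} {q : ℝ[X]}
    (hq : q.degree < n) : L (P n * q) = 0 := by
  suffices h : ∀ N ≤ n, ∀ q : ℝ[X], q.degree < N → L (P n * q) = 0 from h n le_rfl q hq
  intro N
  induction N with
  | zero =>
    intro _ q hq
    have : q = 0 := by
      rw [← degree_eq_bot, ← Nat.WithBot.lt_zero_iff]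
      exact_mod_cast hq
    rw [this, mul_zero, map_zero]
  | succ N ih =>
    intro hN q hq
    have h := ih (by omega) _ (degree_sub_C_mul_lt (hdeg N) hq)
    rw [mul_sub, map_sub, mul_left_comm, ← smul_eq_C_mul, map_smul, hP,
      if_neg (by omega), smul_zero, sub_zero] at h
    exact h

/-- The product of an orthonormal polynomial with one of the same degree: only the leading
coefficient contributes. -/
lemma map_mul_eq_coeff_div (hdeg : ∀ n, (P n).degree = n)
    (hP : ∀ n m, L (P m * P n) = if n = m then 1 else 0) {n : ℕ} {q : ℝ[X]}
    (hq : q.degree < (n + 1 : ℕ)) : L (P n * q) = q.coeff n / (P n).coeff n := by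
  have h := map_mul_eq_zero_of_orthonormal hdeg hP (degree_sub_C_mul_lt (hdeg n) hq)
  rw [mul_sub, map_sub, mul_left_comm, ← smul_eq_C_mul, map_smul, hP, if_pos rfl, smul_eq_mul,
    mul_one, sub_eq_zero] at h
  exact h

lemma degree_X_mul_lt {q : ℝ[X]} {n : ℕ} (hq : q.degree < n) :
    degree (X * q) < (n + 1 : ℕ) := by
  rw [degree_lt_iff_coeff_zero] at *
  intro m hm
  obtain ⟨m, rfl⟩ := Nat.exists_eq_succ_of_ne_zero (by omega : m ≠ 0)
  rw [coeff_X_mul]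
  exact hq m (by omega)

/-- The three-term recurrence relation with coefficients read off from the two highest
coefficients of each polynomial. -/
lemma three_term_recurrence (hL : ∀ p, p ≠ 0 → 0 < L (p * p)) (hdeg : ∀ n, (P n).degree = n)
    (hP : ∀ n m, L (P m * P n) = if n = m then 1 else 0) (n : ℕ) :
    X * P n = C ((P n).coeff n / (P (n + 1)).coeff (n + 1)) * P (n + 1) +
      C ((if n = 0 then 0 else (P n).coeff (n - 1) / (P n).coeff n) -
        (P (n + 1)).coeff n / (P (n + 1)).coeff (n + 1)) * P n +
      C ((P (n - 1)).coeff (n - 1) / (P n).coeff n) * (if n = 0 then 0 else P (n - 1)) := by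
  have hlt : ∀ n, (P n).degree < (n + 1 : ℕ) := fun n => by
    rw [hdeg]; exact_mod_cast Nat.lt_succ_self n
  have hc : ∀ n, (P n).coeff n ≠ 0 := fun n => coeff_ne_zero_of_eq_degree (hdeg n)
  have hz : ∀ n m, n < m → (P n).coeff m = 0 := fun n m h =>
    (degree_lt_iff_coeff_zero _ _).1 (hlt n) m h
  set T := C ((P n).coeff n / (P (n + 1)).coeff (n + 1)) * P (n + 1) +
      C ((if n = 0 then 0 else (P n).coeff (n - 1) / (P n).coeff n) -
        (P (n + 1)).coeff n / (P (n + 1)).coeff (n + 1)) * P n +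
      C ((P (n - 1)).coeff (n - 1) / (P n).coeff n) * (if n = 0 then 0 else P (n - 1)) with hT
  have hR : degree (X * P n - T) < n := by
    rw [degree_lt_iff_coeff_zero]
    intro m hm
    have h1 := hc n
    have h2 := hc (n + 1)
    have h3 : (if n = 0 then (0 : ℝ[X]) else P (n - 1)).coeff m = 0 := by
      split_ifs with h
      · simp
      · exact hz _ _ (by omega)
    have h4 : (X * P n).coeff m = if m = 0 then 0 else (P n).coeff (m - 1) := by
      cases m with
      | zero => simp
      | succ m => rw [coeff_X_mul]; simp
    rw [coeff_sub, hT, coeff_add, coeff_add, coeff_C_mul, coeff_C_mul, coeff_C_mul, h3, h4]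
    rcases hm.eq_or_lt with rfl | hm
    · split_ifs with h
      · subst h; field_simp; ring
      · field_simp; ring
    · rw [if_neg (by omega), hz n m hm]
      rcases Nat.eq_or_lt_of_le hm with rfl | hm
      · simp only [Nat.succ_eq_add_one, Nat.add_sub_cancel]
        field_simp
        ring
      · rw [hz (n + 1) m hm, hz n (m - 1) (by omega)]
        ring
  rw [← sub_eq_zero]
  cases n with
  | zero =>
    rw [← degree_eq_bot, ← Nat.WithBot.lt_zero_iff]
    exact_mod_cast hR
  | succ k =>
    -- The difference has degree at most `k`; it is orthogonal to `P k` by the choice of the last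
    -- coefficient, and to all lower degrees, hence to itself.
    by_contra hne
    have hmul : ∀ q : ℝ[X], q.degree < (k + 1 : ℕ) → L ((X * P (k + 1) - T) * q) =
        L (P (k + 1) * (X * q)) - (P k).coeff k / (P (k + 1)).coeff (k + 1) * L (P k * q) := by
      intro q hq
      have hq' : q.degree < (k + 1 + 1 : ℕ) := hq.trans (by exact_mod_cast Nat.lt_succ_self _)
      rw [hT, if_neg (Nat.succ_ne_zero k), if_neg (Nat.succ_ne_zero k), Nat.add_sub_cancel,
        sub_mul, add_mul, add_mul, map_sub, map_add, map_add]
      simp only [mul_assoc, ← smul_eq_C_mul, smul_mul_assoc, map_smul, smul_eq_mul]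
      rw [map_mul_eq_zero_of_orthonormal hdeg hP hq', map_mul_eq_zero_of_orthonormal hdeg hP hq,
        mul_left_comm]
      ring
    have h0 : ∀ q : ℝ[X], q.degree < k → L ((X * P (k + 1) - T) * q) = 0 := fun q hq => by
      rw [hmul q (hq.trans (by exact_mod_cast Nat.lt_succ_self _)),
        map_mul_eq_zero_of_orthonormal hdeg hP hq,
        map_mul_eq_zero_of_orthonormal hdeg hP (degree_X_mul_lt hq), mul_zero, sub_zero]
    have h1 : L ((X * P (k + 1) - T) * P k) = 0 := by
      rw [hmul _ (hlt k), map_mul_eq_coeff_div hdeg hP (degree_X_mul_lt (hlt k)), coeff_X_mul,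
        hP, if_pos rfl, mul_one, sub_self]
    have h2 := h0 _ (degree_sub_C_mul_lt (hdeg k) hR)
    rw [mul_sub, map_sub, mul_left_comm, ← smul_eq_C_mul, map_smul, h1, smul_zero, sub_zero] at h2
    exact (hL _ hne).ne' h2

end Sequence

/-! ### The moment functional of `ρ_ν²` -/

/-- The functional `p ↦ ∫₀^∞ p(x) ρ_ν(x)² dx`, defined through the values of the moments. -/
noncomputable def momentFunctional (ν : ℝ) : ℝ[X] →ₗ[ℝ] ℝ :=
  Polynomial.lsum fun k => mixedMoment k ν ν • LinearMap.id

lemma momentFunctional_X_pow (ν : ℝ) (k : ℕ) :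
    momentFunctional ν (X ^ k) = mixedMoment k ν ν := by
  simp [momentFunctional, Polynomial.lsum_apply, X_pow_eq_monomial, sum_monomial_index]

lemma integral_eval_mul_rhoWeight_sq {ν : ℝ} (hν : -1 / 2 < ν) (p : ℝ[X]) :
    IntegrableOn (fun x : ℝ => p.eval x * rhoWeight ν x ^ 2) (Ioi 0) ∧
      ∫ x in Ioi (0 : ℝ), p.eval x * rhoWeight ν x ^ 2 = momentFunctional ν p := by
  induction p using Polynomial.induction_on' with
  | add p q hp hq =>
    simp only [eval_add, add_mul, map_add]
    exact ⟨hp.1.add hq.1, by rw [integral_add hp.1 hq.1, hp.2, hq.2]⟩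
  | monomial k a =>
    have h := integral_pow_mul_rhoWeight_sq hν k
    simp only [← C_mul_X_pow_eq_monomial, eval_mul, eval_C, eval_pow, eval_X, mul_assoc]
    refine ⟨h.1.const_mul a, ?_⟩
    rw [integral_const_mul, h.2, ← smul_eq_C_mul, map_smul, momentFunctional_X_pow, smul_eq_mul]

lemma momentFunctional_pos {ν : ℝ} (hν : -1 / 2 < ν) {p : ℝ[X]} (hp : p ≠ 0)
    (hnn : ∀ x, 0 < x → 0 ≤ p.eval x) : 0 < momentFunctional ν p := by
  have h := integral_eval_mul_rhoWeight_sq hν p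
  rw [← h.2]
  refine (setIntegral_pos_iff_support_of_nonneg_ae
    ((ae_restrict_mem measurableSet_Ioi).mono fun x hx => mul_nonneg (hnn x hx) (sq_nonneg _))
    h.1).2 ?_
  have hsub : Ioi (0 : ℝ) \ {x | p.IsRoot x} ⊆
      Function.support (fun x => p.eval x * rhoWeight ν x ^ 2) ∩ Ioi 0 := by
    rintro x ⟨hx, hr⟩
    exact ⟨mul_ne_zero hr (pow_ne_zero 2 (rhoWeight_pos (by linarith) hx).ne'), hx⟩
  refine lt_of_lt_of_le ?_ (measure_mono hsub)
  rw [measure_sdiff_null ((finite_setOfPred_isRoot hp).measure_zero volume)]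
  simp

lemma momentFunctional_mul_self_pos {ν : ℝ} (hν : -1 / 2 < ν) (p : ℝ[X]) (hp : p ≠ 0) :
    0 < momentFunctional ν (p * p) :=
  momentFunctional_pos hν (mul_ne_zero hp hp) fun x _ => by
    rw [eval_mul]; exact mul_self_nonneg _

lemma momentFunctional_X_mul_mul_self_pos {ν : ℝ} (hν : -1 / 2 < ν) (p : ℝ[X]) (hp : p ≠ 0) :
    0 < momentFunctional ν (X * (p * p)) :=
  momentFunctional_pos hν (mul_ne_zero X_ne_zero (mul_ne_zero hp hp)) fun x hx => by
    rw [eval_mul, eval_mul, eval_X]; exact mul_nonneg hx.le (mul_self_nonneg _)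

/-- The moments of `ρ_ν²` in terms of Pochhammer symbols, by Legendre's duplication formula. -/
lemma mixedMoment_self_eq {ν : ℝ} (hν : -1 / 2 < ν) (k : ℕ) :
    mixedMoment k ν ν = Real.sqrt Real.pi *
      (Real.Gamma (1 + 2 * ν) * Real.Gamma (1 + ν) /
        ((2 : ℝ) ^ (1 + 2 * ν) * Real.Gamma (ν + 3 / 2))) *
      ((k.factorial : ℝ) * (poch (1 + 2 * ν) k * poch (1 + ν) k /
          ((4 : ℝ) ^ k * poch (ν + 3 / 2) k))) := by
  have hk : (0 : ℝ) ≤ k := Nat.cast_nonneg k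
  have hd := Real.Gamma_mul_Gamma_add_half (ν + k + 1)
  have p1 : 0 < 1 + 2 * ν := by linarith
  have p2 : 0 < 1 + ν := by linarith
  have p3 : 0 < ν + 3 / 2 := by linarith
  have hpow : (2 : ℝ) ^ (1 - 2 * (ν + k + 1)) = ((2 : ℝ) ^ (1 + 2 * ν) * 4 ^ k)⁻¹ := by
    rw [show (1 - 2 * (ν + k + 1)) = -((1 + 2 * ν) + 2 * k) by ring,
      Real.rpow_neg zero_le_two, Real.rpow_add zero_lt_two, Real.rpow_mul zero_le_two,
      Real.rpow_natCast]
    norm_num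
  have g4 : 0 < Real.Gamma (2 * (ν + k + 1)) := Real.Gamma_pos_of_pos (by linarith)
  have g3 := Real.Gamma_pos_of_pos p3
  have q3 := poch_pos p3 k
  have h2 : (0 : ℝ) < 2 ^ (1 + 2 * ν) := Real.rpow_pos_of_pos zero_lt_two _
  rw [hpow, show ν + k + 1 + 1 / 2 = ν + 3 / 2 + k by ring, Gamma_add_natCast p3 k] at hd
  rw [mixedMoment, show ν + ν + 2 * k + 2 = 2 * (ν + k + 1) by ring,
    show ν + ν + k + 1 = 1 + 2 * ν + k by ring, Gamma_add_natCast p1 k]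
  have h5 : Real.Gamma (ν + k + 1) = poch (1 + ν) k * Real.Gamma (1 + ν) := by
    rw [← Gamma_add_natCast p2 k]; ring_nf
  rw [h5] at hd ⊢
  generalize Real.Gamma (2 * (ν + k + 1)) = g at *
  generalize Real.Gamma (ν + 3 / 2) = g' at *
  generalize poch (ν + 3 / 2) k = q at *
  generalize (2 : ℝ) ^ (1 + 2 * ν) = c at *
  have hπ : Real.sqrt Real.pi =
      poch (1 + ν) k * Real.Gamma (1 + ν) * (q * g') * (c * 4 ^ k) / g := by
    rw [hd]
    field_simp
  rw [hπ]
  field_simp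

/-! ### The determinants and the orthogonal polynomials they define -/

lemma detDk_succ_eq_cramer (ν : ℝ) (n : ℕ) (j : Fin n) :
    detDk ν n (j + 1) = Matrix.cramer (Matrix.of fun m j : Fin n => coeffF ν (j + 1) m)
      (fun m => coeffF ν 0 m) j := by
  rw [detDk, if_neg (Nat.succ_ne_zero _), Matrix.cramer_apply]
  congr 1
  ext m i
  rw [Matrix.updateCol_apply]
  simp only [Matrix.of_apply, Nat.add_right_cancel_iff, Fin.ext_iff]
  split_ifs <;> rfl

/-- Cramer's rule: the numbers `D_{n,0}, …, D_{n,n}` solve the linear system of the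
orthogonality relations. -/
lemma sum_detDk_mul_coeffF (ν : ℝ) {n m : ℕ} (hm : m < n) :
    ∑ k ∈ Finset.range (n + 1), detDk ν n k * coeffF ν k m = 0 := by
  have h := congrFun (Matrix.mulVec_cramer
    (Matrix.of fun m j : Fin n => coeffF ν (j + 1) m) (fun m => coeffF ν 0 m)) ⟨m, hm⟩
  simp only [Matrix.mulVec, dotProduct, Matrix.of_apply, ← detDk_succ_eq_cramer, Pi.smul_apply,
    smul_eq_mul] at h
  rw [Fin.sum_univ_eq_sum_range (fun j => coeffF ν (j + 1) m * detDk ν n (j + 1))] at h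
  have h0 : detDk ν n 0 = -detD ν n := by rw [detDk, if_pos rfl]
  rw [Finset.sum_range_succ', h0, detD]
  simp only [mul_comm (detDk ν n _)]
  rw [h]
  ring

/-- The polynomial `∑_{k ≤ n} D_{n,k} x^k`, which is orthogonal to all lower degrees. -/
noncomputable def detPoly (ν : ℝ) (n : ℕ) : ℝ[X] :=
  ∑ k ∈ Finset.range (n + 1), C (detDk ν n k) * X ^ k

lemma coeff_detPoly (ν : ℝ) {n k : ℕ} (hk : k ≤ n) : (detPoly ν n).coeff k = detDk ν n k := by
  rw [detPoly, finsetSum_coeff]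
  simp only [coeff_C_mul_X_pow]
  rw [Finset.sum_ite_eq, if_pos (Finset.mem_range.2 (Nat.lt_succ_of_le hk))]

lemma degree_detPoly_lt (ν : ℝ) (n : ℕ) : (detPoly ν n).degree < (n + 1 : ℕ) := by
  rw [degree_lt_iff_coeff_zero]
  intro m hm
  rw [detPoly, finsetSum_coeff]
  refine Finset.sum_eq_zero fun k hk => ?_
  rw [coeff_C_mul_X_pow, if_neg (by rw [Finset.mem_range] at hk; omega)]

lemma momentFunctional_detPoly_mul_X_pow (ν : ℝ) (n m : ℕ) :
    momentFunctional ν (detPoly ν n * X ^ m) =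
      ∑ k ∈ Finset.range (n + 1), detDk ν n k * mixedMoment (k + m) ν ν := by
  rw [detPoly, Finset.sum_mul, map_sum]
  refine Finset.sum_congr rfl fun k _ => ?_
  rw [mul_assoc, ← pow_add, ← smul_eq_C_mul, map_smul, momentFunctional_X_pow, smul_eq_mul]

section

variable {ν : ℝ}

lemma rowFactor_ne_zero (hν : -1 / 2 < ν) (m : ℕ) :
    (-1) ^ m / (m.factorial * Real.Gamma (1 + ν)) ≠ 0 := by
  have := Real.Gamma_pos_of_pos (show 0 < 1 + ν by linarith)
  have h1 : (m.factorial : ℝ) ≠ 0 := by positivity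
  exact div_ne_zero (pow_ne_zero _ (by norm_num)) (mul_ne_zero h1 this.ne')

lemma momentFunctional_detPoly_mul_X_pow_of_lt (hν : -1 / 2 < ν) {n m : ℕ} (hm : m < n) :
    momentFunctional ν (detPoly ν n * X ^ m) = 0 := by
  have h := sum_detDk_mul_coeffF ν hm
  simp only [coeffF_eq hν, mul_left_comm (detDk ν n _)] at h
  rw [← Finset.mul_sum] at h
  rw [momentFunctional_detPoly_mul_X_pow]
  exact (mul_eq_zero.1 h).resolve_left (rowFactor_ne_zero hν m)

lemma momentFunctional_detPoly_mul_X_pow_self (hν : -1 / 2 < ν) (n : ℕ) :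
    momentFunctional ν (detPoly ν n * X ^ n) = sumS ν n := by
  rw [momentFunctional_detPoly_mul_X_pow, sumS, Finset.mul_sum]
  refine Finset.sum_congr rfl fun k _ => ?_
  rw [mixedMoment_self_eq hν, add_comm k n]
  ring

/-- A kernel vector of the matrix of `D_n` is the coefficient vector of a polynomial without
constant term that is orthogonal to all lower degrees. -/
lemma detD_ne_zero (hν : -1 / 2 < ν) (n : ℕ) : detD ν n ≠ 0 := by
  intro h
  obtain ⟨v, hv, hker⟩ := Matrix.exists_mulVec_eq_zero_iff.2 h
  set R : ℝ[X] := ∑ j : Fin n, C (v j) * X ^ ((j : ℕ) + 1) with hR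
  have hcoeff : ∀ k, R.coeff k = ∑ j : Fin n, if k = (j : ℕ) + 1 then v j else 0 := fun k => by
    rw [hR, finsetSum_coeff]
    simp only [coeff_C_mul_X_pow]
  have hzero : R = 0 := by
    refine eq_zero_of_coeff_zero_of_forall_map_mul_X_pow (n := n)
      (momentFunctional_X_mul_mul_self_pos hν) ?_ ?_ ?_
    · rw [degree_lt_iff_coeff_zero]
      intro m hm
      rw [hcoeff]
      exact Finset.sum_eq_zero fun j _ => if_neg (by have := j.2; omega)
    · rw [hcoeff]
      exact Finset.sum_eq_zero fun j _ => if_neg (by omega)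
    · intro m hm
      have hk := congrFun hker ⟨m, hm⟩
      simp only [Matrix.mulVec, dotProduct, Matrix.of_apply, coeffF_eq hν, Pi.zero_apply,
        mul_assoc] at hk
      rw [← Finset.mul_sum] at hk
      have hk := (mul_eq_zero.1 hk).resolve_left (rowFactor_ne_zero hν m)
      rw [hR, Finset.sum_mul, map_sum, ← hk]
      refine Finset.sum_congr rfl fun j _ => ?_
      rw [mul_assoc, ← pow_add, ← smul_eq_C_mul, map_smul, momentFunctional_X_pow, smul_eq_mul,
        mul_comm]
  refine hv (funext fun i => ?_)
  have := hcoeff ((i : ℕ) + 1)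
  rw [hzero, coeff_zero, Finset.sum_eq_single i
    (fun j _ hj => if_neg fun h => hj (Fin.ext (by omega)))
    (fun h => absurd (Finset.mem_univ i) h), if_pos rfl] at this
  exact this.symm

lemma detPoly_ne_zero (hν : -1 / 2 < ν) (n : ℕ) : detPoly ν n ≠ 0 := by
  intro h
  have h0 := coeff_detPoly ν (Nat.zero_le n)
  rw [h, coeff_zero, detDk, if_pos rfl] at h0
  exact detD_ne_zero hν n (by linarith)

lemma detDk_self_ne_zero (hν : -1 / 2 < ν) (n : ℕ) : detDk ν n n ≠ 0 := by
  intro h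
  refine detPoly_ne_zero hν n (eq_zero_of_forall_map_mul_X_pow (n := n)
    (momentFunctional_mul_self_pos hν) ?_
    fun m hm => momentFunctional_detPoly_mul_X_pow_of_lt hν hm)
  have hlt := degree_detPoly_lt ν n
  rw [degree_lt_iff_coeff_zero] at hlt ⊢
  intro m hm
  rcases hm.eq_or_lt with rfl | hm
  · rw [coeff_detPoly ν le_rfl, h]
  · exact hlt m hm

lemma degree_detPoly (hν : -1 / 2 < ν) (n : ℕ) : (detPoly ν n).degree = n := by
  refine degree_eq_of_le_of_coeff_ne_zero ?_ ?_
  · rw [degree_le_iff_coeff_zero]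
    exact fun m hm => (degree_lt_iff_coeff_zero _ _).1 (degree_detPoly_lt ν n) m
      (by exact_mod_cast hm)
  · rw [coeff_detPoly ν le_rfl]
    exact detDk_self_ne_zero hν n

lemma momentFunctional_detPoly_mul_of_lt (hν : -1 / 2 < ν) {n : ℕ} {q : ℝ[X]}
    (hq : q.degree < n) : momentFunctional ν (detPoly ν n * q) = 0 :=
  map_mul_eq_zero_of_degree_lt
    (fun _ hm => momentFunctional_detPoly_mul_X_pow_of_lt hν hm) hq

lemma momentFunctional_detPoly_mul_self (hν : -1 / 2 < ν) (n : ℕ) :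
    momentFunctional ν (detPoly ν n * detPoly ν n) = detDk ν n n * sumS ν n := by
  have h : momentFunctional ν
      (detPoly ν n * (detPoly ν n - C ((detPoly ν n).coeff n / (X ^ n : ℝ[X]).coeff n) * X ^ n)) =
      0 := momentFunctional_detPoly_mul_of_lt hν
        (degree_sub_C_mul_lt (degree_X_pow n) (degree_detPoly_lt ν n))
  rw [coeff_detPoly ν le_rfl, coeff_X_pow_self, div_one, mul_sub, map_sub, mul_left_comm,
    ← smul_eq_C_mul, map_smul, momentFunctional_detPoly_mul_X_pow_self hν, smul_eq_mul,
    sub_eq_zero] at h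
  exact h

lemma detDk_self_mul_sumS_pos (hν : -1 / 2 < ν) (n : ℕ) : 0 < detDk ν n n * sumS ν n := by
  rw [← momentFunctional_detPoly_mul_self hν]
  exact momentFunctional_mul_self_pos hν _ (detPoly_ne_zero hν n)

lemma isOrthonormalSeq_iff (hν : -1 / 2 < ν) (P : ℕ → ℝ[X]) :
    IsOrthonormalSeq ν P ↔ (∀ n, (P n).degree = n) ∧
      ∀ n m, momentFunctional ν (P m * P n) = if n = m then 1 else 0 := by
  simp only [IsOrthonormalSeq, ← eval_mul, (integral_eval_mul_rhoWeight_sq hν _).2]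

/-- Every orthonormal sequence consists of multiples of the polynomials `∑ D_{n,k} x^k`. -/
lemma IsOrthonormalSeq.eq_C_mul_detPoly (hν : -1 / 2 < ν) {P : ℕ → ℝ[X]}
    (hP : IsOrthonormalSeq ν P) (n : ℕ) :
    ∃ c : ℝ, P n = C c * detPoly ν n ∧ c ^ 2 * (detDk ν n n * sumS ν n) = 1 := by
  obtain ⟨hdeg, hP⟩ := (isOrthonormalSeq_iff hν P).1 hP
  have hQdeg := degree_detPoly_lt ν n
  have hlt : (P n).degree < (n + 1 : ℕ) := by
    rw [hdeg]; exact_mod_cast Nat.lt_succ_self n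
  have hD := detD_ne_zero hν n
  have hzero : P n - C (-((P n).coeff 0 / detD ν n)) * detPoly ν n = 0 := by
    refine eq_zero_of_coeff_zero_of_forall_map_mul_X_pow (n := n)
      (momentFunctional_X_mul_mul_self_pos hν) ?_ ?_ ?_
    · rw [degree_lt_iff_coeff_zero] at *
      intro m hm
      rw [coeff_sub, coeff_C_mul, hlt m hm, hQdeg m hm, mul_zero, sub_zero]
    · rw [coeff_sub, coeff_C_mul, coeff_detPoly ν (Nat.zero_le n), detDk, if_pos rfl]
      field_simp
      ring
    · intro m hm
      rw [sub_mul, map_sub, mul_assoc, ← smul_eq_C_mul, map_smul,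
        momentFunctional_detPoly_mul_X_pow_of_lt hν hm,
        map_mul_eq_zero_of_orthonormal hdeg hP (by rw [degree_X_pow]; exact_mod_cast hm)]
      simp
  have heq := sub_eq_zero.1 hzero
  refine ⟨_, heq, ?_⟩
  have h1 := hP n n
  rw [if_pos rfl, heq, mul_mul_mul_comm, ← C_mul, ← smul_eq_C_mul, map_smul,
    momentFunctional_detPoly_mul_self hν, smul_eq_mul, ← sq] at h1
  exact h1

lemma isOrthonormalSeq_C_mul_detPoly (hν : -1 / 2 < ν) {c : ℕ → ℝ}
    (hc : ∀ n, c n ^ 2 * (detDk ν n n * sumS ν n) = 1) :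
    IsOrthonormalSeq ν fun n => C (c n) * detPoly ν n := by
  have hc0 : ∀ n, c n ≠ 0 := fun n h => by simpa [h] using hc n
  rw [isOrthonormalSeq_iff hν]
  refine ⟨fun n => by rw [degree_C_mul (hc0 n), degree_detPoly hν], fun n m => ?_⟩
  rw [mul_mul_mul_comm, ← C_mul, ← smul_eq_C_mul, map_smul, smul_eq_mul]
  rcases lt_trichotomy n m with h | rfl | h
  · rw [if_neg h.ne, momentFunctional_detPoly_mul_of_lt hν
      (by rw [degree_detPoly hν]; exact_mod_cast h), mul_zero]
  · rw [if_pos rfl, momentFunctional_detPoly_mul_self hν, ← sq, hc]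
  · rw [if_neg h.ne', mul_comm (detPoly ν m), momentFunctional_detPoly_mul_of_lt hν
      (by rw [degree_detPoly hν]; exact_mod_cast h), mul_zero]

end

lemma mul_sqrt_mul_sqrt_eq {c d s : ℝ} (hc : c ^ 2 * (d * s) = 1) :
    c * (Real.sqrt |d| * Real.sqrt |s|) = 1 ∨ c * (Real.sqrt |d| * Real.sqrt |s|) = -1 := by
  have hds : 0 < d * s := by
    by_contra h
    nlinarith [sq_nonneg c]
  rw [← sq_eq_one_iff, mul_pow, mul_pow, Real.sq_sqrt (abs_nonneg d), Real.sq_sqrt (abs_nonneg s),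
    ← abs_mul, abs_of_pos hds, hc]

lemma sign_mul_self_eq_abs (d : ℝ) : Real.sign d * d = |d| := by
  rcases lt_trichotomy d 0 with h | rfl | h
  · rw [Real.sign_of_neg h, abs_of_neg h, neg_one_mul]
  · simp
  · rw [Real.sign_of_pos h, abs_of_pos h, one_mul]

lemma mul_sqrt_mul_sqrt_eq_sign {c d s : ℝ} (hc : c ^ 2 * (d * s) = 1) (h : 0 < c * d) :
    c * (Real.sqrt |d| * Real.sqrt |s|) = Real.sign d := by
  have hnn : 0 ≤ Real.sqrt |d| * Real.sqrt |s| := by positivity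
  rcases pos_and_pos_or_neg_and_neg_of_mul_pos h with ⟨h1, h2⟩ | ⟨h1, h2⟩
  · rw [Real.sign_of_pos h2]
    refine (mul_sqrt_mul_sqrt_eq hc).resolve_right fun h => ?_
    nlinarith
  · rw [Real.sign_of_neg h2]
    refine (mul_sqrt_mul_sqrt_eq hc).resolve_left fun h => ?_
    nlinarith

/-- A normalising factor is determined by the sign of the leading coefficient. -/
lemma eq_of_sq_mul_eq_one {c c' d s : ℝ} (hc : c ^ 2 * (d * s) = 1) (hc' : c' ^ 2 * (d * s) = 1)
    (h : 0 < c * d) (h' : 0 < c' * d) : c = c' := by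
  have hne : Real.sqrt |d| * Real.sqrt |s| ≠ 0 := fun h0 => by
    rcases mul_sqrt_mul_sqrt_eq hc with h1 | h1 <;> simp [h0] at h1
  exact mul_right_cancel₀ hne
    ((mul_sqrt_mul_sqrt_eq_sign hc h).trans (mul_sqrt_mul_sqrt_eq_sign hc' h').symm)

lemma existsUnique_isOrthonormalSeq {ν : ℝ} (hν : -1 / 2 < ν) :
    ∃! P : ℕ → ℝ[X], IsOrthonormalSeq ν P ∧ ∀ n, 0 < (P n).leadingCoeff := by
  have hlead : ∀ {P : ℕ → ℝ[X]}, IsOrthonormalSeq ν P → ∀ n,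
      (P n).leadingCoeff = (P n).coeff n := fun hP n => by
    rw [leadingCoeff, natDegree_eq_of_degree_eq_some (hP.1 n)]
  have hcoeff : ∀ (c : ℝ) (n : ℕ), (C c * detPoly ν n).coeff n = c * detDk ν n n := fun c n => by
    rw [coeff_C_mul, coeff_detPoly ν le_rfl]
  set c : ℕ → ℝ := fun n => Real.sign (detDk ν n n) / Real.sqrt (detDk ν n n * sumS ν n)
  have hc : ∀ n, c n ^ 2 * (detDk ν n n * sumS ν n) = 1 := fun n => by
    have hpos := detDk_self_mul_sumS_pos hν n
    have hs : Real.sign (detDk ν n n) ^ 2 = 1 := by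
      rcases Real.sign_apply_eq_of_ne_zero _ (detDk_self_ne_zero hν n) with h | h <;>
        rw [h] <;> norm_num
    rw [div_pow, hs, Real.sq_sqrt hpos.le, one_div_mul_cancel hpos.ne']
  have hcpos : ∀ n, 0 < c n * detDk ν n n := fun n => by
    rw [div_mul_eq_mul_div, sign_mul_self_eq_abs]
    exact div_pos (abs_pos.2 (detDk_self_ne_zero hν n))
      (Real.sqrt_pos.2 (detDk_self_mul_sumS_pos hν n))
  have horth := isOrthonormalSeq_C_mul_detPoly hν hc
  refine ⟨_, ⟨horth, fun n => ?_⟩, ?_⟩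
  · rw [hlead horth, hcoeff]
    exact hcpos n
  · rintro P ⟨hP, hpos⟩
    funext n
    obtain ⟨c', hc', hsq⟩ := hP.eq_C_mul_detPoly hν n
    have hp := hpos n
    rw [hlead hP, hc', hcoeff] at hp
    rw [hc', eq_of_sq_mul_eq_one hsq (hc n) hp (hcpos n)]

theorem theorem2 (ν : ℝ) (hν : -1 / 2 < ν) :
    -- all moments of the weight are finite, and the orthonormal sequence exists; it is unique
    -- when the leading coefficients are positive
    (∀ k : ℕ, IntegrableOn (fun x : ℝ => x ^ k * rhoWeight ν x ^ 2) (Ioi 0)) ∧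
    (∃! P : ℕ → ℝ[X], IsOrthonormalSeq ν P ∧ ∀ n, 0 < (P n).leadingCoeff) ∧
    -- the integrals that define `c` and `d` converge, with values given by `₃F₂` at unity
    (∀ n r : ℕ,
      IntegrableOn
        (fun t : ℝ => t ^ ν * Real.exp (-t) * laguerreL ν r t * thetaGamma ν n t) (Ioi 0) ∧
      coeffC ν n r =
        (n.factorial : ℝ) * poch (1 + ν) n ^ 2 *
          (Real.Gamma (2 * ν + n + 1) / Real.Gamma (2 * ν + 2 * n + 2)) *
          hyp3F2 (-(r : ℝ)) (ν + n + 1) (2 * ν + n + 1) (1 + ν) (2 * ν + 2 * n + 2) 1) ∧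
    (∀ m r : ℕ,
      IntegrableOn
        (fun t : ℝ => t ^ (ν + m) * Real.exp (-t) * laguerreL ν m t * laguerreL ν r t) (Ioi 0) ∧
      coeffD ν m r =
        (-1) ^ m / (r.factorial : ℝ) * poch (1 + ν) r * Real.Gamma (1 + ν + m) *
          hyp3F2 (-(r : ℝ)) (ν + m + 1) (m + 1) (1 + ν) 1 1) ∧
    -- the denominators do not vanish, and `D_{n,n}` and `S_n` have the same sign
    (∀ n : ℕ, detD ν n ≠ 0 ∧ 0 < detDk ν n n * sumS ν n) ∧
    ∀ P : ℕ → ℝ[X], IsOrthonormalSeq ν P →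
      -- the coefficients of index `k = 1, …, n`
      (∀ n k : ℕ, 1 ≤ k → k ≤ n →
        (P n).coeff k = -(P n).coeff 0 * (detDk ν n k / detD ν n)) ∧
      -- the free term, up to sign
      (∀ n : ℕ,
        (P n).coeff 0 =
            detD ν n / Real.sqrt |detDk ν n n| * (Real.sqrt |sumS ν n|)⁻¹ ∨
        (P n).coeff 0 =
            -(detD ν n / Real.sqrt |detDk ν n n| * (Real.sqrt |sumS ν n|)⁻¹)) ∧
      -- the sign of the free term and the leading coefficient, when the latter is positive
      (∀ n : ℕ, 0 < (P n).coeff n →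
        (P n).coeff 0 =
            -Real.sign (detDk ν n n) *
              (detD ν n / Real.sqrt |detDk ν n n| * (Real.sqrt |sumS ν n|)⁻¹) ∧
        (P n).coeff n = Real.sqrt |detDk ν n n| * (Real.sqrt |sumS ν n|)⁻¹) ∧
      -- the three-term recurrence relation
      ∃ A B : ℕ → ℝ,
        (∀ n : ℕ, A (n + 1) =
          ((P n).coeff 0 * detD ν (n + 1) * detDk ν n n) /
            ((P (n + 1)).coeff 0 * detD ν n * detDk ν (n + 1) (n + 1))) ∧
        (∀ n : ℕ, A (n + 1) = (P n).coeff n / (P (n + 1)).coeff (n + 1)) ∧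
        (∀ n : ℕ, B n =
          (if n = 0 then 0 else detDk ν n (n - 1) / detDk ν n n) -
            detDk ν (n + 1) n / detDk ν (n + 1) (n + 1)) ∧
        (∀ n : ℕ, B n =
          (if n = 0 then 0 else (P n).coeff (n - 1) / (P n).coeff n) -
            (P (n + 1)).coeff n / (P (n + 1)).coeff (n + 1)) ∧
        ∀ n : ℕ, X * P n =
          C (A (n + 1)) * P (n + 1) + C (B n) * P n +
            C (A n) * (if n = 0 then 0 else P (n - 1)) := by
  have hν1 : 0 < ν + 1 := by linarith
  refine ⟨fun k => (integral_pow_mul_rhoWeight_sq hν k).1, existsUnique_isOrthonormalSeq hν,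
    fun n r => ⟨(integral_laguerreL_mul_thetaGamma hν n r).1, coeffC_eq_hyp3F2 hν n r⟩,
    fun m r => ⟨(integral_laguerreL_mul_laguerreL hν1 m r).1, coeffD_eq_hyp3F2 hν1 m r⟩,
    fun n => ⟨detD_ne_zero hν n, detDk_self_mul_sumS_pos hν n⟩, fun P hP => ?_⟩
  choose c hc hsq using hP.eq_C_mul_detPoly hν
  have hcoeff : ∀ {n k : ℕ}, k ≤ n → (P n).coeff k = c n * detDk ν n k := fun {n k} hk => by
    rw [hc n, coeff_C_mul, coeff_detPoly ν hk]
  have h0 : ∀ n, (P n).coeff 0 = -(c n * detD ν n) := fun n => by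
    rw [hcoeff (Nat.zero_le n), detDk, if_pos rfl, mul_neg]
  have hD := detD_ne_zero hν
  have hDn := detDk_self_ne_zero hν
  have hc0 : ∀ n, c n ≠ 0 := fun n h => by simpa [h] using hsq n
  have hd : ∀ n, Real.sqrt |detDk ν n n| ≠ 0 := fun n =>
    (Real.sqrt_pos.2 (abs_pos.2 (hDn n))).ne'
  have hs : ∀ n, Real.sqrt |sumS ν n| ≠ 0 := fun n =>
    (Real.sqrt_pos.2 (abs_pos.2 (right_ne_zero_of_mul (detDk_self_mul_sumS_pos hν n).ne'))).ne'
  have hfree : ∀ n (e : ℝ), c n * (Real.sqrt |detDk ν n n| * Real.sqrt |sumS ν n|) = e →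
      (P n).coeff 0 = -e * (detD ν n / Real.sqrt |detDk ν n n| * (Real.sqrt |sumS ν n|)⁻¹) := by
    rintro n _ rfl
    have := hd n
    have := hs n
    rw [h0]
    field_simp
  refine ⟨fun n k _ hk => ?_, fun n => ?_, fun n hn => ?_, ?_⟩
  · have := hD n
    rw [hcoeff hk, h0]
    field_simp
  · rcases mul_sqrt_mul_sqrt_eq (hsq n) with h | h
    · exact Or.inr (by rw [hfree n _ h]; ring)
    · exact Or.inl (by rw [hfree n _ h]; ring)
  · rw [hcoeff le_rfl] at hn ⊢
    have hsign := mul_sqrt_mul_sqrt_eq_sign (hsq n) hn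
    refine ⟨hfree n _ hsign, ?_⟩
    have h1 := hd n
    have h2 := hs n
    have h3 : Real.sign (detDk ν n n) * detDk ν n n = Real.sqrt |detDk ν n n| ^ 2 := by
      rw [Real.sq_sqrt (abs_nonneg _), sign_mul_self_eq_abs]
    rw [← hsign] at h3
    rw [eq_mul_inv_iff_mul_eq₀ h2]
    refine mul_right_cancel₀ h1 ?_
    linear_combination h3
  · refine ⟨fun n => (P (n - 1)).coeff (n - 1) / (P n).coeff n,
      fun n => (if n = 0 then 0 else (P n).coeff (n - 1) / (P n).coeff n) -
        (P (n + 1)).coeff n / (P (n + 1)).coeff (n + 1), fun n => ?_, fun n => ?_, fun n => ?_,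
      fun n => rfl, fun n => ?_⟩
    · have := hc0 n
      have := hc0 (n + 1)
      have := hD n
      have := hD (n + 1)
      have := hDn n
      have := hDn (n + 1)
      simp only [Nat.add_sub_cancel]
      rw [hcoeff le_rfl, hcoeff le_rfl, h0, h0]
      field_simp
    · simp only [Nat.add_sub_cancel]
    · simp only
      rw [hcoeff (n.sub_le 1), hcoeff le_rfl, hcoeff (Nat.le_succ n), hcoeff le_rfl,
        mul_div_mul_left _ _ (hc0 n), mul_div_mul_left _ _ (hc0 (n + 1))]
    · obtain ⟨hdeg, horth⟩ := (isOrthonormalSeq_iff hν P).1 hP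
      exact three_term_recurrence (momentFunctional_mul_self_pos hν) hdeg horth n
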